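/- **Theorem (The Beck Gain).** For integers $s\ge 0$ and $0\le j<2^s$ let $h_{s,j}$ be the function on $\mathbb R$ that is $-1$ on the left half of $[j2^{-s},(j+1)2^{-s})$, $+1$ on its right half, and $0$ elsewhere. For $\vec r=(r_1,r_2,r_3)\in\mathbb Z_{\ge 0}^3$, an *$\mathsf r$-function with parameter $\vec r$* is a function on $[0,1]^3$ of the form $$ f(x)=\sum_{R}\varepsilon_R\,h_R(x),\qquad \varepsilon_R\in\{\pm1\},$$ where $R$ runs over the dyadic rectangles $R=\prod_{k=1}^3[j_k2^{-r_k},(j_k+1)2^{-r_k})\subset[0,1)^3$ and $h_R(x)=\prod_{k=1}^3h_{r_k,j_k}(x_k)$. Let $\mathbb H_n$ be the set of $\vec r\in\mathbb Z_{\ge0}^3$ with $r_1+r_2+r_3=n$. Divide $\{1,\dots,n\}$ into $q$ consecutive disjoint nonempty intervals $I_1,\dots,I_q$, and put $\mathbb A_t=\{\vec r\in\mathbb H_n: r_1\in I_t\}$ and $\rho=\sqrt q\,n^{-1}$. For each $\vec r\in\mathbb H_n$ let $f_{\vec r}$ be an $\mathsf r$-function with parameter $\vec r$. For $V\subset\{1,\dots,q\}$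 let $\operatorname{NSD}(V)$ be the set of tuples $(\vec r_j)_{j\in V}\in\prod_{j\in V}\mathbb A_j$ such that for every $j\in V$ there are $j'\in V\setminus\{j\}$ and $\ell\in\{2,3\}$ with $r_{j,\ell}=r_{j',\ell}$, and let $$\operatorname{Prod}(\operatorname{NSD}(V))=\sum_{(\vec r_j)\in\operatorname{NSD}(V)}\ \prod_{j\in V}f_{\vec r_j}.$$ Then there are absolute constants $C_0,C_1,C_2,C_3,\eta>0$ such that, for all $n\ge1$, all $q$, all such divisions $I_1,\dots,I_q$, all such choices of the functions $f_{\vec r}$, all $V\subset\{1,\dots,q\}$ and all $1\le p<\infty$, $$\rho^{|V|}\,\bigl\|\operatorname{Prod}(\operatorname{NSD}(V))\bigr\|_{L^p([0,1]^3)}\le\bigl[C_0\,|V|^{C_1}\,p^{C_2}\,q^{C_3}\,n^{-\eta}\bigr]^{|V|},$$ where the right-hand side is read as $1$ when $V=\emptyset$ (in which case $\operatorname{Prod}(\operatorname{NSD}(V))=1$). -/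

import Mathlib

namespace BeckGain

open MeasureTheory

noncomputable section

/-- The dyadic interval `[j 2⁻ˢ, (j+1) 2⁻ˢ)`. -/
def dyadicInterval (s j : ℕ) : Set ℝ :=
  Set.Ico ((j : ℝ) / 2 ^ s) (((j : ℝ) + 1) / 2 ^ s)

/-- The `L^∞`-normalized Haar function of the interval `dyadicInterval s j`:
`-1` on its left half, `+1` on its right half, `0` elsewhere. -/
def haar (s j : ℕ) (x : ℝ) : ℝ :=
  -(dyadicInterval (s + 1) (2 * j)).indicator 1 x +
    (dyadicInterval (s + 1) (2 * j + 1)).indicator 1 x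

/-- The dyadic rectangles in the unit cube `[0,1)³` with side lengths `2^{-r 0}, 2^{-r 1}, 2^{-r 2}`,
given by the positions of their sides. -/
abbrev Rect (r : Fin 3 → ℕ) : Type := (k : Fin 3) → Fin (2 ^ r k)

/-- The tensor product Haar function of a dyadic rectangle. -/
def haarRect (r : Fin 3 → ℕ) (R : Rect r) (x : Fin 3 → ℝ) : ℝ :=
  ∏ k, haar (r k) (R k) (x k)

/-- `f` is an r-function with parameter `r`. -/
def IsRFunction (r : Fin 3 → ℕ) (f : (Fin 3 → ℝ) → ℝ) : Prop :=
  ∃ ε : Rect r → ℝ, (∀ R, ε R = 1 ∨ ε R = -1) ∧ ∀ x, f x = ∑ R, ε R * haarRect r R x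

end

/-- The hyperbolic vectors: triples of nonnegative integers with sum `n`.
The coordinates are indexed by `0, 1, 2`. -/
def hyp (n : ℕ) : Finset (Fin 3 → ℕ) := Finset.Nat.antidiagonalTuple 3 n

/-- `I` divides `{1, …, n}` into `q` (nonempty, disjoint) consecutive intervals. -/
structure IsIntervalDivision (n : ℕ) {q : ℕ} (I : Fin q → Finset ℕ) : Prop where
  interval : ∀ t, ∃ a b : ℕ, a ≤ b ∧ I t = Finset.Icc a b
  increasing : ∀ s t, s < t → ∀ x ∈ I s, ∀ y ∈ I t, x < y
  cover : ∀ x, x ∈ Finset.Icc 1 n ↔ ∃ t, x ∈ I t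

/-- The hyperbolic vectors whose first coordinate lies in the `t`-th interval. -/
def block (n : ℕ) {q : ℕ} (I : Fin q → Finset ℕ) (t : Fin q) : Finset (Fin 3 → ℕ) :=
  (hyp n).filter fun r => r 0 ∈ I t

/-- Tuples `(r_j)_{j ∈ V}` with `r_j` in the `j`-th block in which every `r_j` agrees with some other
`r_{j'}` in the second or in the third coordinate. -/
def NSD (n : ℕ) {q : ℕ} (I : Fin q → Finset ℕ) (V : Finset (Fin q)) :
    Finset (V → Fin 3 → ℕ) :=
  (Fintype.piFinset fun j : V => block n I j).filter fun r =>
    ∀ j : V, ∃ j' : V, j' ≠ j ∧ (r j 1 = r j' 1 ∨ r j 2 = r j' 2)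

noncomputable section

/-- The sum, over the tuples in `C`, of the products of the functions `f r_j`. -/
def sumProd {ι : Type*} [Fintype ι] (f : (Fin 3 → ℕ) → (Fin 3 → ℝ) → ℝ)
    (C : Finset (ι → Fin 3 → ℕ)) (x : Fin 3 → ℝ) : ℝ :=
  ∑ r ∈ C, ∏ j, f (r j) x

/-- Lebesgue measure on the unit cube `[0,1]³`. -/
def cubeMeasure : Measure (Fin 3 → ℝ) := volume.restrict (Set.Icc 0 1)

/-- The normalization `ρ = √q / n`. -/
def rho (q n : ℕ) : ℝ := Real.sqrt q / n

end

end BeckGain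

/-!
On the grid of dyadic cells of side `2 ^ (-(n + 1))` the r-functions are constant on cells, and the
one with parameter `r` is, in each coordinate `k`, a martingale difference of level `r k`: it is odd
under the flip of the `r k`-th binary digit and invariant under the flips of later digits. A sum of
such functions with distinct levels obeys a Littlewood–Paley inequality in `L ^ (2 * m)` with
constant linear in `m`.

Put `N = n + 1`. A hyperbolic vector is determined by its last two coordinates `(a, b)`, so a sum
with a prescribed pattern of coincidences is a sum over `A` values of `a` and `B` values of `b`. If
the coincidences are not enforced beyond the pattern, the sum over each single `b` is a
Littlewood–Paley sum in the first coordinate, because the intervals are increasing; this saves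
`√N` and gives the bound `N ^ (A + B / 2)`. The pattern is a bipartite graph on the `A + B` values
with the indices `j ∈ V` as edges, and splits into components, in which the number of values
exceeds the number of edges by at most one. The two bounds `N ^ (A + B / 2)` and `N ^ (B + A / 2)`
beat `N` per edge except for a single pair and for a path with three edges; there, a pair of
r-functions that share one coordinate is squared out and estimated by a second Littlewood–Paley
argument, which yields the missing power of `N`.

Finally, a sum over assignments with values that are required to be distinct is an average, over
random colourings of the range of parameters, of unconstrained sums.
-/

namespace BeckGain

open Finset MeasureTheory

section Moments

variable {Ω : Type*} [Fintype Ω]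

/-- The normalized `k`-th absolute moment of `F` on the finite space `Ω` is at most `A ^ k`.
This multiplied-out form of an `L^k` bound keeps roots and divisions by `#Ω` out of the
calculations. -/
def MomentLE (k : ℕ) (F : Ω → ℝ) (A : ℝ) : Prop :=
  ∑ ω, |F ω| ^ k ≤ A ^ k * Fintype.card Ω

theorem MomentLE.mono {k : ℕ} {F : Ω → ℝ} {A B : ℝ} (h : MomentLE k F A) (hA : 0 ≤ A)
    (hAB : A ≤ B) : MomentLE k F B :=
  h.trans (by gcongr)

theorem MomentLE.of_abs_le {k : ℕ} {F : Ω → ℝ} {A : ℝ} (h : ∀ ω, |F ω| ≤ A) :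
    MomentLE k F A :=
  calc ∑ ω, |F ω| ^ k ≤ ∑ _ω : Ω, A ^ k := sum_le_sum fun ω _ => by
        gcongr
        exact h ω
    _ = A ^ k * Fintype.card Ω := by simp [mul_comm]

theorem MomentLE.const_mul {k : ℕ} {F : Ω → ℝ} {A : ℝ} (h : MomentLE k F A) (c : ℝ) :
    MomentLE k (fun ω => c * F ω) (|c| * A) := by
  unfold MomentLE at *
  simp only [abs_mul, mul_pow, ← mul_sum, mul_assoc]
  gcongr

theorem MomentLE.sum_div_pow_le {k : ℕ} {F : Ω → ℝ} {A : ℝ} (h : MomentLE k F A) (hA : 0 < A) :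
    ∑ ω, (|F ω| / A) ^ k ≤ Fintype.card Ω := by
  simp only [div_pow, ← sum_div]
  rw [div_le_iff₀' (by positivity)]
  exact h

theorem MomentLE.sum {ι : Type*} {k : ℕ} {s : Finset ι} {F : ι → Ω → ℝ} {A : ι → ℝ}
    (hA : ∀ i ∈ s, 0 < A i) (h : ∀ i ∈ s, MomentLE k (F i) (A i)) :
    MomentLE k (fun ω => ∑ i ∈ s, F i ω) (∑ i ∈ s, A i) := by
  rcases s.eq_empty_or_nonempty with rfl | hs
  · exact MomentLE.of_abs_le (by simp)
  set S := ∑ i ∈ s, A i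
  have hS : 0 < S := sum_pos hA hs
  -- Jensen's inequality for the convex combination `∑ (A i / S) (|F i ω| / A i)`.
  have jensen (ω : Ω) : |∑ i ∈ s, F i ω| ^ k ≤ S ^ k * ∑ i ∈ s, A i / S * (|F i ω| / A i) ^ k := by
    have hsum : ∑ i ∈ s, |F i ω| = S * ∑ i ∈ s, A i / S * (|F i ω| / A i) := by
      rw [mul_sum]
      refine sum_congr rfl fun i hi => ?_
      have := hA i hi
      field_simp
    calc |∑ i ∈ s, F i ω| ^ k ≤ (∑ i ∈ s, |F i ω|) ^ k := by
          gcongr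
          exact abs_sum_le_sum_abs _ _
      _ ≤ _ := by
          rw [hsum, mul_pow]
          gcongr
          refine Real.pow_arith_mean_le_arith_mean_pow s (fun i => A i / S) _
            (fun i hi => (div_pos (hA i hi) hS).le) ?_
            (fun i hi => div_nonneg (abs_nonneg _) (hA i hi).le) k
          rw [← sum_div, div_self hS.ne']
  calc ∑ ω, |∑ i ∈ s, F i ω| ^ k
      ≤ ∑ ω, S ^ k * ∑ i ∈ s, A i / S * (|F i ω| / A i) ^ k := sum_le_sum fun ω _ => jensen ω
    _ = S ^ k * ∑ i ∈ s, A i / S * ∑ ω, (|F i ω| / A i) ^ k := by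
        rw [← mul_sum, sum_comm]
        simp only [mul_sum]
    _ ≤ S ^ k * ∑ i ∈ s, A i / S * Fintype.card Ω := by
        gcongr with i hi
        · exact (div_pos (hA i hi) hS).le
        · exact (h i hi).sum_div_pow_le (hA i hi)
    _ = S ^ k * Fintype.card Ω := by
        rw [← sum_mul, ← sum_div, div_self hS.ne', one_mul]

theorem prod_le_sum_pow_card_div_card {ι : Type*} {s : Finset ι} (hs : s.Nonempty) {y : ι → ℝ}
    (hy : ∀ i ∈ s, 0 ≤ y i) : ∏ i ∈ s, y i ≤ (∑ i ∈ s, y i ^ #s) / #s := by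
  have hc : #s ≠ 0 := hs.card_pos.ne'
  calc ∏ i ∈ s, y i = ∏ i ∈ s, (y i ^ #s) ^ (#s : ℝ)⁻¹ :=
        prod_congr rfl fun i hi => (Real.pow_rpow_inv_natCast (hy i hi) hc).symm
    _ ≤ ∑ i ∈ s, (#s : ℝ)⁻¹ * y i ^ #s :=
        Real.geom_mean_le_arith_mean_weighted s _ _ (fun _ _ => by positivity) (by simp [hc])
          fun i hi => pow_nonneg (hy i hi) _
    _ = (∑ i ∈ s, y i ^ #s) / #s := by rw [← mul_sum, div_eq_inv_mul]

theorem MomentLE.prod {ι : Type*} {k : ℕ} {s : Finset ι} {F : ι → Ω → ℝ} {A : ι → ℝ}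
    (hA : ∀ i ∈ s, 0 < A i) (h : ∀ i ∈ s, MomentLE (k * #s) (F i) (A i)) :
    MomentLE k (fun ω => ∏ i ∈ s, F i ω) (∏ i ∈ s, A i) := by
  rcases s.eq_empty_or_nonempty with rfl | hs
  · exact MomentLE.of_abs_le (by simp)
  have hP : 0 < (∏ i ∈ s, A i) ^ k := pow_pos (prod_pos hA) _
  have hc : (0 : ℝ) < #s := by exact_mod_cast hs.card_pos
  have amgm (ω : Ω) : |∏ i ∈ s, F i ω| ^ k
      ≤ (∏ i ∈ s, A i) ^ k * ((∑ i ∈ s, (|F i ω| / A i) ^ (k * #s)) / #s) := by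
    have := prod_le_sum_pow_card_div_card hs (y := fun i => (|F i ω| / A i) ^ k)
      fun i hi => pow_nonneg (div_nonneg (abs_nonneg _) (hA i hi).le) _
    simp only [← pow_mul] at this
    rwa [prod_pow, prod_div_distrib, div_pow, ← abs_prod, div_le_iff₀' hP] at this
  calc ∑ ω, |∏ i ∈ s, F i ω| ^ k
      ≤ ∑ ω, (∏ i ∈ s, A i) ^ k * ((∑ i ∈ s, (|F i ω| / A i) ^ (k * #s)) / #s) :=
        sum_le_sum fun ω _ => amgm ω
    _ = (∏ i ∈ s, A i) ^ k * ((∑ i ∈ s, ∑ ω, (|F i ω| / A i) ^ (k * #s)) / #s) := by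
        rw [← mul_sum, ← sum_div, sum_comm]
    _ ≤ (∏ i ∈ s, A i) ^ k * ((∑ _i ∈ s, (Fintype.card Ω : ℝ)) / #s) := by
        gcongr with i hi
        exact (h i hi).sum_div_pow_le (hA i hi)
    _ = _ := by rw [sum_const, nsmul_eq_mul, mul_div_cancel_left₀ _ hc.ne']

theorem MomentLE.mul {k : ℕ} {F G : Ω → ℝ} {A B : ℝ} (hA : 0 < A) (hB : 0 < B)
    (hF : MomentLE (2 * k) F A) (hG : MomentLE (2 * k) G B) :
    MomentLE k (fun ω => F ω * G ω) (A * B) := by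
  simpa using MomentLE.prod (k := k) (s := univ) (F := ![F, G]) (A := ![A, B])
    (by simp [Fin.forall_fin_two, hA, hB]) (by simp [Fin.forall_fin_two, mul_comm k, hF, hG])

end Moments

section LittlewoodPaley

theorem succ_mul_mul_pow_le {a b : ℝ} (ha : 0 ≤ a) (hb : 0 ≤ b) (k : ℕ) :
    (k + 1) * (a * b ^ k) ≤ a ^ (k + 1) + k * b ^ (k + 1) := by
  have := prod_le_sum_pow_card_div_card (univ_nonempty (α := Fin (k + 1)))
    (y := Fin.cons a fun _ => b) fun i _ => by cases i using Fin.cases <;> simpa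
  rw [card_univ, Fintype.card_fin, le_div_iff₀ (by positivity)] at this
  simpa [Fin.prod_univ_succ, Fin.sum_univ_succ, mul_comm] using this

theorem even_pow_tangent_le (u x : ℝ) (l : ℕ) :
    u ^ (2 * (l + 1)) + 2 * (l + 1) * u ^ (2 * l + 1) * (x - u) ≤ x ^ (2 * (l + 1)) := by
  have amgm := succ_mul_mul_pow_le (abs_nonneg x) (abs_nonneg u) (2 * l + 1)
  have he : Even (2 * (l + 1)) := even_two_mul _
  rw [show 2 * l + 1 + 1 = 2 * (l + 1) by ring, he.pow_abs, he.pow_abs] at amgm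
  push_cast at amgm
  have habs : x * u ^ (2 * l + 1) ≤ |x| * |u| ^ (2 * l + 1) := by
    rw [← abs_pow, ← abs_mul]
    exact le_abs_self _
  have hpow : u ^ (2 * l + 1) * u = u ^ (2 * (l + 1)) := by ring
  nlinarith [mul_le_mul_of_nonneg_left habs (by positivity : 0 ≤ 2 * ((l : ℝ) + 1))]

theorem even_pow_le_avg (x d : ℝ) (l : ℕ) :
    2 * x ^ (2 * l) ≤ (x + d) ^ (2 * l) + (x - d) ^ (2 * l) := by
  have h := (even_two_mul l).add_pow_le (a := x + d) (b := x - d)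
  rw [show x + d + (x - d) = 2 * x by ring, mul_pow] at h
  cases l with
  | zero => norm_num
  | succ l =>
    have : (2 : ℝ) ^ (2 * (l + 1)) = 2 ^ (2 * (l + 1) - 1) * 2 := by
      rw [← pow_succ, Nat.sub_add_cancel (by omega)]
    rw [this, mul_assoc] at h
    exact le_of_mul_le_mul_left h (by positivity)

theorem mul_sub_pow_sub_pow_le (u w : ℝ) (l : ℕ) :
    (u - w) * (u ^ (2 * l + 1) - w ^ (2 * l + 1)) ≤
      (u - w) ^ 2 * ((2 * l + 1) * (u ^ (2 * l) + w ^ (2 * l))) := by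
  have he := even_two_mul l
  have hmax : max |u| |w| ^ (2 * l) ≤ u ^ (2 * l) + w ^ (2 * l) := by
    rcases max_choice |u| |w| with h | h <;> rw [h, he.pow_abs]
    · exact le_add_of_nonneg_right (he.pow_nonneg w)
    · exact le_add_of_nonneg_left (he.pow_nonneg u)
  calc _ ≤ |u - w| * |u ^ (2 * l + 1) - w ^ (2 * l + 1)| := by
        rw [← abs_mul]
        exact le_abs_self _
    _ ≤ |u - w| * (|u - w| * (2 * l + 1 : ℕ) * max |u| |w| ^ (2 * l)) := by
        gcongr
        exact abs_pow_sub_pow_le u w (2 * l + 1)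
    _ = (u - w) ^ 2 * ((2 * l + 1) * max |u| |w| ^ (2 * l)) := by
        rw [← sq_abs (u - w)]
        push_cast
        ring
    _ ≤ _ := by gcongr

theorem even_pow_avg_le (x d : ℝ) (l : ℕ) :
    (x + d) ^ (2 * (l + 1)) + (x - d) ^ (2 * (l + 1)) ≤ 2 * x ^ (2 * (l + 1)) +
      8 * (l + 1) ^ 2 * (d ^ 2 * ((x + d) ^ (2 * l) + (x - d) ^ (2 * l))) := by
  have tangent_add := even_pow_tangent_le (x + d) x l
  have tangent_sub := even_pow_tangent_le (x - d) x l
  have slopes := mul_sub_pow_sub_pow_le (x + d) (x - d) l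
  have hP : 0 ≤ d ^ 2 * ((x + d) ^ (2 * l) + (x - d) ^ (2 * l)) :=
    mul_nonneg (sq_nonneg d) (add_nonneg ((even_two_mul l).pow_nonneg _)
      ((even_two_mul l).pow_nonneg _))
  have := mul_le_mul_of_nonneg_left slopes (by positivity : 0 ≤ (l : ℝ) + 1)
  have := mul_nonneg (by positivity : 0 ≤ (l : ℝ) + 1) hP
  linarith

variable {Ω : Type*}

/-- `p` is odd under the `c`-th flip and invariant under all later flips. When `τ c` flips the
`c`-th binary digit, these are the martingale differences of the dyadic filtration. -/
def IsLevel (τ : ℕ → Equiv.Perm Ω) (c : ℕ) (p : Ω → ℝ) : Prop :=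
  (∀ ω, p (τ c ω) = -p ω) ∧ ∀ c', c < c' → ∀ ω, p (τ c' ω) = p ω

theorem IsLevel.mul_prod_lower {ι : Type*} {τ : ℕ → Equiv.Perm Ω} {c : ℕ} {p : Ω → ℝ}
    {s : Finset ι} {g : ι → Ω → ℝ} (hp : IsLevel τ c p)
    (hg : ∀ i ∈ s, ∃ c' < c, IsLevel τ c' (g i)) :
    IsLevel τ c (fun ω => p ω * ∏ i ∈ s, g i ω) := by
  have hinv : ∀ e, c ≤ e → ∀ ω, ∏ i ∈ s, g i (τ e ω) = ∏ i ∈ s, g i ω := fun e he ω =>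
    prod_congr rfl fun i hi =>
      have ⟨_, hlt, hlevel⟩ := hg i hi
      hlevel.2 e (hlt.trans_le he) ω
  exact ⟨fun ω => by simp only [hp.1, hinv c le_rfl, neg_mul],
    fun e he ω => by simp only [hp.2 _ he, hinv e he.le]⟩

theorem IsLevel.mul_lower {τ : ℕ → Equiv.Perm Ω} {c c' : ℕ} {p g : Ω → ℝ} (hp : IsLevel τ c p)
    (hg : IsLevel τ c' g) (h : c' < c) : IsLevel τ c (fun ω => p ω * g ω) := by
  simpa using hp.mul_prod_lower (s := {()}) (g := fun _ => g) fun _ _ => ⟨c', h, hg⟩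

theorem IsLevel.sum {ι : Type*} {τ : ℕ → Equiv.Perm Ω} {c : ℕ} {s : Finset ι} {p : ι → Ω → ℝ}
    (hp : ∀ i ∈ s, IsLevel τ c (p i)) : IsLevel τ c (fun ω => ∑ i ∈ s, p i ω) :=
  ⟨fun ω => by rw [← sum_neg_distrib]; exact sum_congr rfl fun i hi => (hp i hi).1 ω,
    fun e he ω => sum_congr rfl fun i hi => (hp i hi).2 e he ω⟩

theorem IsLevel.sum_mul_sum_lower {ι κ : Type*} {τ : ℕ → Equiv.Perm Ω} {c : ℕ} {s : Finset ι}
    {t : Finset κ} {p : ι → Ω → ℝ} {g : ι → κ → Ω → ℝ} (hp : ∀ i, p i ≠ 0 → IsLevel τ c (p i))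
    (hg : ∀ i k, p i ≠ 0 → g i k ≠ 0 → ∃ c' < c, IsLevel τ c' (g i k)) :
    IsLevel τ c (fun ω => ∑ i ∈ s, p i ω * ∑ k ∈ t, g i k ω) := by
  simp only [mul_sum]
  refine IsLevel.sum fun i _ => IsLevel.sum fun k _ => ?_
  by_cases hi : p i = 0
  · simp [hi, IsLevel]
  by_cases hk : g i k = 0
  · simp [hk, IsLevel]
  obtain ⟨c', hlt, hlevel⟩ := hg i k hi hk
  exact (hp i hi).mul_lower hlevel hlt

variable [Fintype Ω]

theorem two_mul_sum_eq_sum_add_perm (σ : Equiv.Perm Ω) (g : Ω → ℝ) :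
    2 * ∑ ω, g ω = ∑ ω, (g ω + g (σ ω)) := by
  rw [sum_add_distrib, Equiv.sum_comp σ g, two_mul]

theorem sum_even_pow_add_odd_le {σ : Equiv.Perm Ω} {d F Q : Ω → ℝ} {l : ℕ}
    (hd : ∀ ω, d (σ ω) = -d ω) (hF : ∀ ω, F (σ ω) = F ω) (hQ : ∀ ω, Q (σ ω) = Q ω)
    (hQ0 : ∀ ω, 0 ≤ Q ω) (h : ∑ ω, F ω ^ (2 * (l + 1)) ≤
      8 * (l + 1) ^ 2 * ∑ ω, Q ω * F ω ^ (2 * l)) :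
    ∑ ω, (F ω + d ω) ^ (2 * (l + 1)) ≤
      8 * (l + 1) ^ 2 * ∑ ω, (Q ω + d ω ^ 2) * (F ω + d ω) ^ (2 * l) := by
  have symm_left := two_mul_sum_eq_sum_add_perm σ fun ω => (F ω + d ω) ^ (2 * (l + 1))
  have symm_right := two_mul_sum_eq_sum_add_perm σ fun ω =>
    (Q ω + d ω ^ 2) * (F ω + d ω) ^ (2 * l)
  simp only [hd, hF, hQ, neg_sq, ← sub_eq_add_neg, ← mul_add] at symm_left symm_right
  have pointwise (ω : Ω) : (F ω + d ω) ^ (2 * (l + 1)) + (F ω - d ω) ^ (2 * (l + 1)) ≤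
      2 * F ω ^ (2 * (l + 1)) - 8 * (l + 1) ^ 2 * (2 * (Q ω * F ω ^ (2 * l))) +
        8 * (l + 1) ^ 2 *
          ((Q ω + d ω ^ 2) * ((F ω + d ω) ^ (2 * l) + (F ω - d ω) ^ (2 * l))) := by
    have hFQ := mul_le_mul_of_nonneg_left (mul_le_mul_of_nonneg_left
      (even_pow_le_avg (F ω) (d ω) l) (hQ0 ω)) (by positivity : 0 ≤ 8 * ((l : ℝ) + 1) ^ 2)
    have hd2 := even_pow_avg_le (F ω) (d ω) l
    linarith
  have := sum_le_sum fun ω (_ : ω ∈ univ) => pointwise ω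
  simp only [sum_add_distrib, sum_sub_distrib, ← mul_sum] at this symm_left symm_right
  rw [← symm_left, ← symm_right] at this
  linarith

theorem sum_even_pow_le_of_isLevel {ι : Type*} {τ : ℕ → Equiv.Perm Ω}
    {lev : ι → ℕ} {d : ι → Ω → ℝ} (l : ℕ) (s : Finset ι) (hinj : Set.InjOn lev s)
    (hd : ∀ i ∈ s, IsLevel τ (lev i) (d i)) :
    ∑ ω, (∑ i ∈ s, d i ω) ^ (2 * (l + 1)) ≤
      8 * (l + 1) ^ 2 * ∑ ω, (∑ i ∈ s, d i ω ^ 2) * (∑ i ∈ s, d i ω) ^ (2 * l) := by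
  classical
  induction s using Finset.induction_on_max_value lev with
  | empty => simp
  | insert a s ha hmax ih =>
    have hlt : ∀ i ∈ s, lev i < lev a := fun i hi => (hmax i hi).lt_of_ne fun h =>
      ha (hinj (by simp [hi]) (by simp) h ▸ hi)
    have hinv : ∀ i ∈ s, ∀ ω, d i (τ (lev a) ω) = d i ω := fun i hi =>
      (hd i (mem_insert_of_mem hi)).2 _ (hlt i hi)
    simp only [sum_insert ha, add_comm (d a _), add_comm (d a _ ^ 2)]
    exact sum_even_pow_add_odd_le (hd a (mem_insert_self _ _)).1
      (fun ω => sum_congr rfl fun i hi => hinv i hi ω)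
      (fun ω => sum_congr rfl fun i hi => by rw [hinv i hi ω])
      (fun ω => sum_nonneg fun i _ => sq_nonneg _)
      (ih (hinj.mono (by simp)) fun i hi => hd i (mem_insert_of_mem hi))

theorem sum_even_pow_le_of_le_sum_sq_mul {F Q : Ω → ℝ} {l : ℕ} {c : ℝ} (hc : 0 ≤ c)
    (hQ : ∀ ω, 0 ≤ Q ω)
    (h : ∑ ω, F ω ^ (2 * (l + 1)) ≤ c * ∑ ω, Q ω * F ω ^ (2 * l)) :
    ∑ ω, F ω ^ (2 * (l + 1)) ≤ ∑ ω, (c * Q ω) ^ (l + 1) := by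
  have amgm (ω : Ω) : (l + 1) * (c * (Q ω * F ω ^ (2 * l))) ≤
      (c * Q ω) ^ (l + 1) + l * F ω ^ (2 * (l + 1)) := by
    have := succ_mul_mul_pow_le (mul_nonneg hc (hQ ω)) (sq_nonneg (F ω)) l
    rw [← pow_mul, ← pow_mul] at this
    linarith
  have hsum := sum_le_sum fun ω (_ : ω ∈ univ) => amgm ω
  simp only [sum_add_distrib, ← mul_sum] at hsum
  have := mul_le_mul_of_nonneg_left h (by positivity : 0 ≤ (l : ℝ) + 1)
  linarith

/-- The Littlewood–Paley inequality for dyadic martingales, with linear growth of the constant. -/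
theorem MomentLE.of_sum_sq {ι : Type*} {τ : ℕ → Equiv.Perm Ω}
    {lev : ι → ℕ} {d : ι → Ω → ℝ} {m : ℕ} (hm : 1 ≤ m) {s : Finset ι} (hinj : Set.InjOn lev s)
    (hd : ∀ i ∈ s, IsLevel τ (lev i) (d i)) {R : ℝ}
    (hS : MomentLE m (fun ω => ∑ i ∈ s, d i ω ^ 2) (R ^ 2)) :
    MomentLE (2 * m) (fun ω => ∑ i ∈ s, d i ω) (3 * m * R) := by
  obtain ⟨l, rfl⟩ : ∃ l, m = l + 1 := ⟨m - 1, by omega⟩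
  have hQ0 (ω : Ω) : 0 ≤ ∑ i ∈ s, d i ω ^ 2 := sum_nonneg fun i _ => sq_nonneg _
  calc ∑ ω, |∑ i ∈ s, d i ω| ^ (2 * (l + 1))
      = ∑ ω, (∑ i ∈ s, d i ω) ^ (2 * (l + 1)) := by simp only [(even_two_mul (l + 1)).pow_abs]
    _ ≤ ∑ ω, (8 * (l + 1) ^ 2 * ∑ i ∈ s, d i ω ^ 2) ^ (l + 1) :=
        sum_even_pow_le_of_le_sum_sq_mul (by positivity) hQ0
          (sum_even_pow_le_of_isLevel l s hinj hd)
    _ = (8 * (l + 1) ^ 2) ^ (l + 1) * ∑ ω, |∑ i ∈ s, d i ω ^ 2| ^ (l + 1) := by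
        simp only [mul_sum univ, mul_pow _ (Finset.sum s _), abs_of_nonneg (hQ0 _)]
    _ ≤ (9 * (l + 1) ^ 2) ^ (l + 1) * ((R ^ 2) ^ (l + 1) * Fintype.card Ω) := by
        gcongr
        · norm_num
        · exact hS
    _ = (3 * (l + 1 : ℕ) * R) ^ (2 * (l + 1)) * Fintype.card Ω := by
        push_cast
        rw [pow_mul, ← mul_assoc, ← mul_pow]
        ring_nf

theorem MomentLE.of_isLevel {ι : Type*} [Fintype ι] {τ : ℕ → Equiv.Perm Ω}
    {lev : ι → ℕ} {d : ι → Ω → ℝ} {m : ℕ} (hm : 1 ≤ m)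
    (hinj : ∀ i j, d i ≠ 0 → d j ≠ 0 → lev i = lev j → i = j)
    (hd : ∀ i, d i ≠ 0 → IsLevel τ (lev i) (d i)) (hb : ∀ i ω, |d i ω| ≤ 1) :
    MomentLE (2 * m) (fun ω => ∑ i, d i ω) (3 * m * √(Fintype.card ι)) := by
  classical
  have hsum : (fun ω => ∑ i, d i ω) = fun ω => ∑ i with d i ≠ 0, d i ω := by
    funext ω
    exact (sum_filter_of_ne (p := fun i => d i ≠ 0) fun i _ hi h => hi (congrFun h ω)).symm
  rw [hsum]
  refine MomentLE.of_sum_sq (lev := lev) hm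
    (fun i hi j hj => hinj i j (by simpa using hi) (by simpa using hj))
    (fun i hi => hd i (by simpa using hi)) (MomentLE.of_abs_le fun ω => ?_)
  rw [abs_of_nonneg (sum_nonneg fun _ _ => sq_nonneg _), Real.sq_sqrt (Nat.cast_nonneg _)]
  calc ∑ i with d i ≠ 0, d i ω ^ 2 ≤ ∑ i, d i ω ^ 2 :=
        sum_le_sum_of_subset_of_nonneg (filter_subset _ _) fun _ _ _ => sq_nonneg _
    _ ≤ ∑ _i : ι, (1 : ℝ) := sum_le_sum fun i _ => (sq_le_one_iff_abs_le_one _).2 (hb i ω)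
    _ = Fintype.card ι := by simp

end LittlewoodPaley

section HaarSystems

/-- The hyperbolic vector in `hyp n` with second coordinate `a` and third coordinate `b`; the
subtraction is only meaningful for `a + b ≤ n`. -/
def param (n a b : ℕ) : Fin 3 → ℕ := ![n - a - b, a, b]

theorem param_swap (n a b : ℕ) (k : Fin 3) : param n a b (Equiv.swap 1 2 k) = param n b a k := by
  fin_cases k
  · exact Nat.sub_right_comm n a b
  · exact congrArg (param n a b) (Equiv.swap_apply_left 1 2)
  · exact congrArg (param n a b) (Equiv.swap_apply_right 1 2)

variable {Ω W : Type*} {n : ℕ} {τ : Fin 3 → ℕ → Equiv.Perm Ω}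

/-- Functions `G j a b` that behave like r-functions with parameter `param n a b`, where `τ k c`
flips the `c`-th digit of the `k`-th coordinate and the first parameter increases with the
index `j`. Entries outside the range of parameters are `0`. -/
structure HaarSystem [LinearOrder W] (n : ℕ) (τ : Fin 3 → ℕ → Equiv.Perm Ω)
    (G : W → Fin (n + 1) → Fin (n + 1) → Ω → ℝ) : Prop where
  abs_le : ∀ j a b ω, |G j a b ω| ≤ 1
  isLevel : ∀ j (a b : Fin (n + 1)) k, IsLevel (τ k) (param n a b k) (G j a b)
  add_le : ∀ {j a b}, G j a b ≠ 0 → (a : ℕ) + b ≤ n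
  add_lt : ∀ {i j a b a' b'}, i < j → G i a b ≠ 0 → G j a' b' ≠ 0 → (a' : ℕ) + b' < (a : ℕ) + b

/-- The sum over all assignments of the second parameters, indexed by `A`, and of the third
parameters, indexed by `B`: the factor `j` has second parameter `x (κ j)` and third parameter
`y (ℓ j)`, so `κ` and `ℓ` prescribe which parameters coincide. -/
def freeSum {A B : Type*} [Fintype A] [Fintype B] [DecidableEq A] [DecidableEq B] [Fintype W]
    (G : W → Fin (n + 1) → Fin (n + 1) → Ω → ℝ) (κ : W → A) (ℓ : W → B) (ω : Ω) : ℝ :=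
  ∑ x : A → Fin (n + 1), ∑ y : B → Fin (n + 1), ∏ j, G j (x (κ j)) (y (ℓ j)) ω

theorem freeSum_swap {A B : Type*} [Fintype A] [Fintype B] [DecidableEq A] [DecidableEq B]
    [Fintype W] (G : W → Fin (n + 1) → Fin (n + 1) → Ω → ℝ) (κ : W → A) (ℓ : W → B) :
    freeSum (fun j a b => G j b a) ℓ κ = freeSum G κ ℓ :=
  funext fun _ => sum_comm

section

variable [LinearOrder W] {G : W → Fin (n + 1) → Fin (n + 1) → Ω → ℝ}

theorem HaarSystem.swap (hG : HaarSystem n τ G) :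
    HaarSystem n (fun k => τ (Equiv.swap 1 2 k)) (fun j a b => G j b a) where
  abs_le j a b := hG.abs_le j b a
  isLevel j a b k := param_swap n b a k ▸ hG.isLevel j b a (Equiv.swap 1 2 k)
  add_le h := add_comm (G := ℕ) _ _ ▸ hG.add_le h
  add_lt hij h h' := by
    have := hG.add_lt hij h h'
    omega

theorem HaarSystem.restrict (hG : HaarSystem n τ G) (P : W → Fin (n + 1) → Fin (n + 1) → Prop)
    [∀ j a b, Decidable (P j a b)] :
    HaarSystem n τ (fun j a b ω => if P j a b then G j a b ω else 0) := by
  have hne : ∀ {j a b}, (fun ω => if P j a b then G j a b ω else 0) ≠ 0 → G j a b ≠ 0 :=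
    fun h h0 => h (funext fun ω => by simp [h0])
  refine ⟨fun j a b ω => ?_, fun j a b k => ?_, fun h => hG.add_le (hne h),
    fun hij h h' => hG.add_lt hij (hne h) (hne h')⟩
  · split_ifs
    · exact hG.abs_le j a b ω
    · simp
  · by_cases h : P j a b
    · simpa only [h, if_true] using hG.isLevel j a b k
    · simp [h, IsLevel]

theorem HaarSystem.comp {W' : Type*} [LinearOrder W'] (hG : HaarSystem n τ G) {g : W' → W}
    (hg : StrictMono g) : HaarSystem n τ (fun j => G (g j)) where
  abs_le _ := hG.abs_le _
  isLevel _ := hG.isLevel _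
  add_le h := hG.add_le h
  add_lt hij h h' := hG.add_lt (hg hij) h h'

theorem HaarSystem.column [Fintype Ω] (hG : HaarSystem n τ G) {s : Finset W} (hs : s.Nonempty)
    (x : W → Fin (n + 1)) {m : ℕ} (hm : 1 ≤ m) :
    MomentLE (2 * m) (fun ω => ∑ b, ∏ j ∈ s, G j (x j) b ω) (3 * m * √(n + 1)) := by
  set k := s.max' hs
  have hks : k ∈ s := s.max'_mem hs
  have hfactor : ∀ b, (fun ω => ∏ j ∈ s, G j (x j) b ω) ≠ 0 → ∀ j ∈ s, G j (x j) b ≠ 0 :=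
    fun b h j hj h0 => h (funext fun ω => prod_eq_zero hj (congrFun h0 ω))
  have hcolumn := MomentLE.of_isLevel (τ := τ 0) (lev := fun b : Fin (n + 1) => n - x k - b)
    (d := fun b ω => ∏ j ∈ s, G j (x j) b ω) hm ?_ ?_ ?_
  · simpa using hcolumn
  · intro b b' hb hb' h
    have := hG.add_le (hfactor b hb k hks)
    have := hG.add_le (hfactor b' hb' k hks)
    omega
  · intro b hb
    simp only [← mul_prod_erase s (fun j => G j (x j) b _) hks]
    refine (hG.isLevel k (x k) b 0).mul_prod_lower fun j hj => ⟨_, ?_, hG.isLevel j (x j) b 0⟩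
    have hjs := mem_of_mem_erase hj
    have hlt : j < k := (s.le_max' j hjs).lt_of_ne (ne_of_mem_erase hj)
    have := hG.add_lt hlt (hfactor b hb j hjs) (hfactor b hb k hks)
    have := hG.add_le (hfactor b hb j hjs)
    change n - x j - b < n - x k - b
    omega
  · intro b ω
    rw [abs_prod]
    exact prod_le_one (fun _ _ => abs_nonneg _) fun j _ => hG.abs_le _ _ _ _

end

variable {A B : Type*} [Fintype A] [Fintype B] [DecidableEq A] [DecidableEq B] [Fintype W]
  {κ : W → A} {ℓ : W → B}

theorem freeSum_eq_sum_prod_column (G : W → Fin (n + 1) → Fin (n + 1) → Ω → ℝ) (κ : W → A)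
    (ℓ : W → B) : freeSum G κ ℓ =
      fun ω => ∑ x : A → Fin (n + 1), ∏ β, ∑ b, ∏ j with ℓ j = β, G j (x (κ j)) b ω := by
  funext ω
  refine sum_congr rfl fun x _ => ?_
  rw [prod_univ_sum, Fintype.piFinset_univ]
  refine sum_congr rfl fun y _ => ?_
  rw [← prod_fiberwise univ ℓ]
  refine prod_congr rfl fun β _ => prod_congr rfl fun j hj => ?_
  rw [(mem_filter.1 hj).2]

theorem HaarSystem.freeSum_columns [LinearOrder W] [Nonempty W] [Fintype Ω]
    {G : W → Fin (n + 1) → Fin (n + 1) → Ω → ℝ} (hG : HaarSystem n τ G)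
    (hℓ : Function.Surjective ℓ) {m : ℕ} (hm : 1 ≤ m) :
    MomentLE (2 * m) (freeSum G κ ℓ) ((n + 1 : ℝ) ^ Fintype.card A *
      (3 * (m * Fintype.card B : ℕ) * √(n + 1)) ^ Fintype.card B) := by
  have : Nonempty B := Nonempty.map ℓ inferInstance
  have hmB : 1 ≤ m * Fintype.card B := Nat.mul_pos hm Fintype.card_pos
  set R : ℝ := 3 * (m * Fintype.card B : ℕ) * √(n + 1)
  have hR : 0 < R := by positivity
  have hsum : (n + 1 : ℝ) ^ Fintype.card A * R ^ Fintype.card B =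
      ∑ _x : A → Fin (n + 1), ∏ _β : B, R := by simp
  rw [freeSum_eq_sum_prod_column, hsum]
  refine MomentLE.sum (fun _ _ => prod_pos fun _ _ => hR) fun x _ =>
    MomentLE.prod (fun _ _ => hR) fun β _ => ?_
  obtain ⟨j, hj⟩ := hℓ β
  rw [card_univ, mul_assoc]
  exact hG.column ⟨j, by simp [hj]⟩ (fun j => x (κ j)) hmB

end HaarSystems

section Pairs

section TTStar

variable {Ω : Type*} [Fintype Ω]

theorem sum_sq_sum_mul_eq {ι α : Type*} [Fintype ι] [Fintype α] (h : ι → α → ℝ) (Φ : α → ℝ) :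
    ∑ c, (∑ a, h c a * Φ a) ^ 2 = ∑ p : α × α, Φ p.1 * Φ p.2 * ∑ c, h c p.1 * h c p.2 := by
  simp only [sq, sum_mul_sum]
  simp only [Fintype.sum_prod_type, mul_sum]
  rw [sum_comm]
  refine sum_congr rfl fun a _ => ?_
  rw [sum_comm]
  exact sum_congr rfl fun a' _ => sum_congr rfl fun c _ => by ring

/-- The `TT*` argument: expanding the square, only the diagonal lacks cancellation in `c`. -/
theorem MomentLE.sum_sq_sum_mul {ι α : Type*} [Fintype ι] [Fintype α] {h : ι → α → Ω → ℝ}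
    {Φ : α → Ω → ℝ} {m : ℕ} {X M : ℝ} (hX0 : 0 < X) (hM : 0 < M) (hh : ∀ c a ω, |h c a ω| ≤ 1)
    (hX : ∀ a a', a ≠ a' → MomentLE (2 * m) (fun ω => ∑ c, h c a ω * h c a' ω) X)
    (hΦ : ∀ a, MomentLE (2 * (2 * m)) (Φ a) M) :
    MomentLE m (fun ω => ∑ c, (∑ a, h c a ω * Φ a ω) ^ 2)
      (M ^ 2 * (Fintype.card α * Fintype.card ι + Fintype.card α ^ 2 * X)) := by
  classical
  have hdiag (a : α) (ω : Ω) : |∑ c, h c a ω * h c a ω| ≤ Fintype.card ι := by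
    calc |∑ c, h c a ω * h c a ω| ≤ ∑ c, |h c a ω * h c a ω| := abs_sum_le_sum_abs _ _
      _ ≤ ∑ _c : ι, (1 : ℝ) := sum_le_sum fun c _ => by
          rw [abs_mul]
          exact mul_le_one₀ (hh c a ω) (abs_nonneg _) (hh c a ω)
      _ = Fintype.card ι := by simp
  have hcross (a a' : α) : MomentLE (2 * m) (fun ω => ∑ c, h c a ω * h c a' ω)
      (X + if a = a' then (Fintype.card ι : ℝ) else 0) := by
    split_ifs with haa
    · subst haa
      exact MomentLE.of_abs_le fun ω => (hdiag a ω).trans (by linarith)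
    · simpa using hX a a' haa
  have hpos (a a' : α) : 0 < X + if a = a' then (Fintype.card ι : ℝ) else 0 := by
    split_ifs <;> positivity
  have htotal : M ^ 2 * (Fintype.card α * Fintype.card ι + Fintype.card α ^ 2 * X) =
      ∑ p : α × α, M * M * (X + if p.1 = p.2 then (Fintype.card ι : ℝ) else 0) := by
    simp [← mul_sum, sum_add_distrib, Fintype.sum_prod_type]
    ring
  simp only [sum_sq_sum_mul_eq, htotal]
  exact MomentLE.sum (fun p _ => mul_pos (mul_pos hM hM) (hpos p.1 p.2)) fun p _ =>
    ((hΦ p.1).mul hM hM (hΦ p.2)).mul (mul_pos hM hM) (hpos p.1 p.2) (hcross p.1 p.2)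

variable {n : ℕ} {σ τ : ℕ → Equiv.Perm Ω} {h : Fin (n + 1) → Fin (n + 1) → Ω → ℝ} {m : ℕ}

theorem MomentLE.sum_mul_of_isLevel (hm : 1 ≤ m) (hh : ∀ c a ω, |h c a ω| ≤ 1)
    (hle : ∀ {c a}, h c a ≠ 0 → (a : ℕ) + c ≤ n)
    (hσ : ∀ c a, h c a ≠ 0 → IsLevel σ (n - a - c) (h c a)) {a a' : Fin (n + 1)} (haa : a ≠ a') :
    MomentLE (2 * m) (fun ω => ∑ c, h c a ω * h c a' ω) (3 * m * √(n + 1)) := by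
  wlog hlt : a < a' generalizing a a'
  · simpa only [mul_comm] using this haa.symm (haa.lt_or_gt.resolve_left hlt)
  have hne : ∀ c, (fun ω => h c a ω * h c a' ω) ≠ 0 → h c a ≠ 0 ∧ h c a' ≠ 0 := fun c hc =>
    ⟨fun h0 => hc (funext fun ω => by simp [h0]), fun h0 => hc (funext fun ω => by simp [h0])⟩
  have hcross := MomentLE.of_isLevel (τ := σ) (lev := fun c : Fin (n + 1) => n - a - c)
    (d := fun c ω => h c a ω * h c a' ω) hm ?_ ?_ ?_
  · simpa using hcross
  · intro c c' hc hc' heq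
    have := hle (hne c hc).2
    have := hle (hne c' hc').2
    omega
  · intro c hc
    have := hle (hne c hc).2
    exact (hσ c a (hne c hc).1).mul_lower (hσ c a' (hne c hc).2) (by omega)
  · intro c ω
    rw [abs_mul]
    exact mul_le_one₀ (hh _ _ _) (abs_nonneg _) (hh _ _ _)

theorem MomentLE.sum_sum_mul_of_isLevel (hm : 1 ≤ m) {Φ : Fin (n + 1) → Ω → ℝ} {M : ℝ}
    (hM : 0 < M) (hh : ∀ c a ω, |h c a ω| ≤ 1) (hle : ∀ {c a}, h c a ≠ 0 → (a : ℕ) + c ≤ n)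
    (hσ : ∀ c a, h c a ≠ 0 → IsLevel σ (n - a - c) (h c a))
    (hτ : ∀ c : Fin (n + 1), IsLevel τ c (fun ω => ∑ a, h c a ω * Φ a ω))
    (hΦ : ∀ a, MomentLE (2 * (2 * m)) (Φ a) M) :
    MomentLE (2 * m) (fun ω => ∑ c, ∑ a, h c a ω * Φ a ω)
      (9 * m ^ 2 * M * (n + 1 : ℝ) ^ (5 / 4 : ℝ)) := by
  have hm' : (1 : ℝ) ≤ m := by exact_mod_cast hm
  have hN : (1 : ℝ) ≤ √(n + 1) := Real.one_le_sqrt.2 (by simp)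
  have hsq : ((n + 1 : ℝ) ^ (5 / 4 : ℝ)) ^ 2 = (n + 1) ^ 2 * √(n + 1) := by
    rw [Real.sqrt_eq_rpow, ← Real.rpow_natCast, ← Real.rpow_natCast,
      ← Real.rpow_mul (by positivity), ← Real.rpow_add (by positivity)]
    norm_num
  have hsquare : MomentLE m (fun ω => ∑ c, (∑ a, h c a ω * Φ a ω) ^ 2)
      ((3 * m * M * (n + 1 : ℝ) ^ (5 / 4 : ℝ)) ^ 2) := by
    refine (MomentLE.sum_sq_sum_mul (by positivity) hM hh
      (fun a a' => MomentLE.sum_mul_of_isLevel hm hh hle hσ) hΦ).mono (by positivity) ?_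
    calc M ^ 2 * (Fintype.card (Fin (n + 1)) * Fintype.card (Fin (n + 1)) +
          Fintype.card (Fin (n + 1)) ^ 2 * (3 * m * √(n + 1)))
        = M ^ 2 * (n + 1) ^ 2 * (1 + 3 * m * √(n + 1)) := by
          simp only [Fintype.card_fin]
          push_cast
          ring
      _ ≤ M ^ 2 * (n + 1) ^ 2 * (9 * m ^ 2 * √(n + 1)) := by
          gcongr
          have hmN : 1 ≤ m * √((n : ℝ) + 1) := one_le_mul_of_one_le_of_one_le hm' hN
          nlinarith
      _ = _ := by rw [mul_pow _ (_ ^ (5 / 4 : ℝ)), hsq]; ring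
  convert MomentLE.of_sum_sq hm (lev := fun c : Fin (n + 1) => (c : ℕ)) (s := univ)
    (fun _ _ _ _ => Fin.ext) (fun c _ => hτ c) hsquare using 1
  ring

end TTStar

/-- The reflection `b ↦ n - a - b`, an involution of the indices `b` with `a + b ≤ n`; beyond
them it takes the value `0`. -/
def reflect {n : ℕ} (a b : Fin (n + 1)) : Fin (n + 1) := ⟨n - a - b, by omega⟩

theorem sum_reflect {n : ℕ} {a : Fin (n + 1)} {F : Fin (n + 1) → ℝ}
    (hF : ∀ b, F b ≠ 0 → (a : ℕ) + b ≤ n) :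
    ∑ c : Fin (n + 1), (if (a : ℕ) + c ≤ n then F (reflect a c) else 0) = ∑ b, F b := by
  rw [← sum_filter, ← sum_filter_of_ne (p := fun b : Fin (n + 1) => (a : ℕ) + b ≤ n)
    fun b _ => hF b]
  refine sum_nbij' (reflect a) (reflect a) ?_ ?_ ?_ ?_ fun _ _ => rfl <;>
  · intro b hb
    simp only [mem_filter, mem_univ, true_and, reflect, Fin.ext_iff] at *
    omega

namespace HaarSystem

variable {Ω W : Type*} [Fintype Ω] [LinearOrder W] {n : ℕ} {τ : Fin 3 → ℕ → Equiv.Perm Ω}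
  {G : W → Fin (n + 1) → Fin (n + 1) → Ω → ℝ} {i j : W} {T : Finset (Fin (n + 1))} {m : ℕ} {M : ℝ}

theorem pair_of_lt (hG : HaarSystem n τ G) (hij : i < j) (hm : 1 ≤ m) (hM : 0 < M)
    (hΦ : ∀ a, MomentLE (2 * (2 * m)) (fun ω => ∑ b ∈ T, G j a b ω) M) :
    MomentLE (2 * m) (fun ω => ∑ a, ∑ b, G i a b ω * ∑ b' ∈ T, G j a b' ω)
      (9 * m ^ 2 * M * (n + 1 : ℝ) ^ (5 / 4 : ℝ)) := by
  rw [show (fun ω => ∑ a, ∑ b, G i a b ω * ∑ b' ∈ T, G j a b' ω) =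
    fun ω => ∑ b, ∑ a, G i a b ω * ∑ b' ∈ T, G j a b' ω from funext fun ω => sum_comm]
  refine MomentLE.sum_sum_mul_of_isLevel (σ := τ 0) (τ := τ 2) (h := fun b a => G i a b) hm hM
    (fun _ _ => hG.abs_le _ _ _) hG.add_le (fun b a _ => hG.isLevel i a b 0) (fun b => ?_) hΦ
  refine IsLevel.sum_mul_sum_lower (fun a _ => hG.isLevel i a b 2) fun a b' hi hj =>
    ⟨b', ?_, hG.isLevel j a b' 2⟩
  have := hG.add_lt hij hi hj
  omega

theorem pair_of_gt (hG : HaarSystem n τ G) (hij : j < i) (hm : 1 ≤ m) (hM : 0 < M)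
    (hΦ : ∀ a, MomentLE (2 * (2 * m)) (fun ω => ∑ b ∈ T, G j a b ω) M) :
    MomentLE (2 * m) (fun ω => ∑ a, ∑ b, G i a b ω * ∑ b' ∈ T, G j a b' ω)
      (9 * m ^ 2 * M * (n + 1 : ℝ) ^ (5 / 4 : ℝ)) := by
  -- Reflecting `b` makes the index `c = n - a - b` the level in the first coordinate.
  set h : Fin (n + 1) → Fin (n + 1) → Ω → ℝ := fun c a ω =>
    if (a : ℕ) + c ≤ n then G i a (reflect a c) ω else 0 with hh
  have hle : ∀ {c a}, h c a ≠ 0 → (a : ℕ) + c ≤ n := fun {c a} hca => by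
    by_contra hn
    exact hca (funext fun ω => if_neg hn)
  have heq : ∀ {c a}, h c a ≠ 0 → h c a = G i a (reflect a c) := fun hca =>
    funext fun ω => if_pos (hle hca)
  have habs : ∀ c a ω, |h c a ω| ≤ 1 := fun c a ω => by
    simp only [hh]
    split_ifs
    · exact hG.abs_le _ _ _ _
    · simp
  have hre : (fun ω => ∑ a, ∑ b, G i a b ω * ∑ b' ∈ T, G j a b' ω) =
      fun ω => ∑ c, ∑ a, h c a ω * ∑ b' ∈ T, G j a b' ω := by
    funext ω
    rw [sum_comm (f := fun c a => h c a ω * ∑ b' ∈ T, G j a b' ω)]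
    refine sum_congr rfl fun a _ => ?_
    rw [← sum_mul, ← sum_mul, sum_reflect (a := a) (F := fun b => G i a b ω)]
    exact fun b hb => hG.add_le fun h0 => hb (congrFun h0 ω)
  rw [hre]
  refine MomentLE.sum_sum_mul_of_isLevel (σ := τ 2) (τ := τ 0) hm hM habs hle
    (fun c a hca => heq hca ▸ hG.isLevel i a (reflect a c) 2) (fun c => ?_) hΦ
  refine IsLevel.sum_mul_sum_lower (fun a ha => ?_) fun a b' hi hj =>
    ⟨n - a - b', ?_, hG.isLevel j a b' 0⟩
  · have hlevel := hG.isLevel i a (reflect a c) 0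
    have hc : n - a - (n - a - c) = (c : ℕ) := by have := hle ha; omega
    rwa [← heq ha, show param n a (reflect a c) 0 = c from hc] at hlevel
  · have hlt := hG.add_lt hij hj (heq hi ▸ hi)
    have := hG.add_le hj
    have := hle hi
    simp only [reflect] at hlt
    omega

theorem pair (hG : HaarSystem n τ G) (hij : i ≠ j) (hm : 1 ≤ m) (hM : 0 < M)
    (hΦ : ∀ a, MomentLE (2 * (2 * m)) (fun ω => ∑ b ∈ T, G j a b ω) M) :
    MomentLE (2 * m) (fun ω => ∑ a, ∑ b, G i a b ω * ∑ b' ∈ T, G j a b' ω)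
      (9 * m ^ 2 * M * (n + 1 : ℝ) ^ (5 / 4 : ℝ)) :=
  hij.lt_or_gt.elim (fun h => hG.pair_of_lt h hm hM hΦ) fun h => hG.pair_of_gt h hm hM hΦ

end HaarSystem

end Pairs

section Connected

/-- Every index shares its second parameter `κ` or its third parameter `ℓ` with another index. -/
def NoIsolated {W A B : Type*} (κ : W → A) (ℓ : W → B) : Prop :=
  ∀ j, ∃ j', j' ≠ j ∧ (κ j = κ j' ∨ ℓ j = ℓ j')

theorem NoIsolated.swap {W A B : Type*} {κ : W → A} {ℓ : W → B} (h : NoIsolated κ ℓ) :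
    NoIsolated ℓ κ := fun j =>
  have ⟨j', hne, heq⟩ := h j
  ⟨j', hne, heq.symm⟩

theorem sum_fun_pair {A T M : Type*} [Fintype A] [DecidableEq A] [Fintype T] [AddCommMonoid M]
    {α β : A} (hne : α ≠ β) (h : ∀ γ, γ = α ∨ γ = β) (F : T → T → M) :
    ∑ x : A → T, F (x α) (x β) = ∑ a, ∑ b, F a b := by
  rw [← Fintype.sum_prod_type']
  refine Fintype.sum_bijective (fun x : A → T => (x α, x β)) ⟨fun x y hxy => ?_, fun p => ?_⟩ _ _
    fun _ => rfl
  · obtain ⟨hα, hβ⟩ := Prod.ext_iff.1 hxy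
    funext γ
    rcases h γ with rfl | rfl <;> assumption
  · exact ⟨fun γ => if γ = α then p.1 else p.2, by simp [hne.symm]⟩

theorem exists_map_ne_of_surjective {W C : Type*} [Fintype C] {f : W → C}
    (hf : Function.Surjective f) (hC : 1 < Fintype.card C) (c : C) : ∃ j, f j ≠ c := by
  have := Fintype.one_lt_card_iff_nontrivial.1 hC
  obtain ⟨d, hd⟩ := exists_ne c
  obtain ⟨j, rfl⟩ := hf d
  exact ⟨j, hd⟩

theorem exists_path_of_card {W A B : Type*} [Fintype W] [DecidableEq W] [Fintype A] [Fintype B]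
    {κ : W → A} {ℓ : W → B} (hκ : Function.Surjective κ) (hℓ : Function.Surjective ℓ)
    (hA : Fintype.card A = 2) (hB : Fintype.card B = 2) (hW : Fintype.card W = 3)
    (hns : NoIsolated κ ℓ) :
    ∃ i j k : W, i ≠ j ∧ i ≠ k ∧ j ≠ k ∧ (univ : Finset W) = {i, j, k} ∧ κ i = κ j ∧
      κ i ≠ κ k ∧ ℓ j = ℓ k ∧ ℓ i ≠ ℓ j := by
  have htriple {i j k : W} (hij : i ≠ j) (hik : i ≠ k) (hjk : j ≠ k) :
      (univ : Finset W) = {i, j, k} :=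
    (eq_univ_of_card _ (by rw [hW, card_eq_three]; exact ⟨i, j, k, hij, hik, hjk, rfl⟩)).symm
  obtain ⟨p, q, hpq, hκpq⟩ := Fintype.exists_ne_map_eq_of_card_lt κ (by omega)
  obtain ⟨k, hκk⟩ := exists_map_ne_of_surjective hκ (by omega) (κ p)
  have hpk : p ≠ k := fun h => hκk (h ▸ rfl)
  have hqk : q ≠ k := fun h => hκk (h ▸ hκpq.symm)
  obtain ⟨i, j, hij, hik, hjk, hκij, hκik, hℓjk⟩ :
      ∃ i j, i ≠ j ∧ i ≠ k ∧ j ≠ k ∧ κ i = κ j ∧ κ i ≠ κ k ∧ ℓ j = ℓ k := by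
    obtain ⟨j, hjk, hj⟩ := hns k
    have hjpq : j = p ∨ j = q := by
      have := htriple hpq hpk hqk ▸ mem_univ j
      simpa [hjk] using this
    rcases hjpq with rfl | rfl
    · exact ⟨q, j, hpq.symm, hqk, hpk, hκpq.symm, hκpq ▸ hκk.symm, (hj.resolve_left hκk).symm⟩
    · exact ⟨p, j, hpq, hpk, hqk, hκpq, hκk.symm, (hj.resolve_left (hκpq ▸ hκk)).symm⟩
  refine ⟨i, j, k, hij, hik, hjk, htriple hij hik hjk, hκij, hκik, hℓjk, fun hℓij => ?_⟩
  obtain ⟨e, he⟩ := exists_map_ne_of_surjective hℓ (by omega) (ℓ j)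
  have hmem := htriple hij hik hjk ▸ mem_univ e
  simp only [mem_insert, mem_singleton] at hmem
  rcases hmem with rfl | rfl | rfl
  exacts [he hℓij, he rfl, he hℓjk.symm]

section

variable {Ω W A B : Type*} [Fintype W] [DecidableEq W] [Fintype A] [Fintype B] [DecidableEq A]
  [DecidableEq B] {n : ℕ} {κ : W → A} {ℓ : W → B} {i j k : W}

theorem freeSum_eq_of_pair (G : W → Fin (n + 1) → Fin (n + 1) → Ω → ℝ) [Unique A] (hij : i ≠ j)
    (huniv : (univ : Finset W) = {i, j}) (hℓ : Function.Surjective ℓ) (hℓij : ℓ i ≠ ℓ j) :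
    freeSum G κ ℓ = fun ω => ∑ a, ∑ b, G i a b ω * ∑ b', G j a b' ω := by
  funext ω
  have hB : ∀ β, β = ℓ i ∨ β = ℓ j := fun β => by
    obtain ⟨e, rfl⟩ := hℓ β
    rcases (by simpa [huniv] using mem_univ e : e = i ∨ e = j) with rfl | rfl <;> simp
  calc freeSum G κ ℓ ω = ∑ x : A → Fin (n + 1), ∑ y : B → Fin (n + 1),
        G i (x default) (y (ℓ i)) ω * G j (x default) (y (ℓ j)) ω := by
        simp only [freeSum, huniv, prod_pair hij, Unique.eq_default (κ _)]
    _ = ∑ x : A → Fin (n + 1), ∑ b, ∑ b', G i (x default) b ω * G j (x default) b' ω :=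
        sum_congr rfl fun x _ => sum_fun_pair hℓij hB fun b b' =>
          G i (x default) b ω * G j (x default) b' ω
    _ = ∑ a, ∑ b, ∑ b', G i a b ω * G j a b' ω :=
        (Equiv.funUnique A (Fin (n + 1))).sum_comp fun a => ∑ b, ∑ b', G i a b ω * G j a b' ω
    _ = _ := by simp only [mul_sum]

theorem freeSum_eq_of_path (G : W → Fin (n + 1) → Fin (n + 1) → Ω → ℝ) (hij : i ≠ j)
    (hik : i ≠ k) (hjk : j ≠ k) (huniv : (univ : Finset W) = {i, j, k})
    (hκ : Function.Surjective κ) (hℓ : Function.Surjective ℓ) (hκij : κ i = κ j)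
    (hκik : κ i ≠ κ k) (hℓjk : ℓ j = ℓ k) (hℓij : ℓ i ≠ ℓ j) :
    freeSum G κ ℓ = fun ω => ∑ b, (∑ c, G k c b ω) * ∑ a, ∑ b', G i a b' ω * G j a b ω := by
  funext ω
  have hall : ∀ e, e = i ∨ e = j ∨ e = k := fun e => by simpa [huniv] using mem_univ e
  have hA : ∀ α, α = κ i ∨ α = κ k := fun α => by
    obtain ⟨e, rfl⟩ := hκ α
    rcases hall e with rfl | rfl | rfl <;> simp [hκij]
  have hB : ∀ β, β = ℓ i ∨ β = ℓ j := fun β => by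
    obtain ⟨e, rfl⟩ := hℓ β
    rcases hall e with rfl | rfl | rfl <;> simp [hℓjk]
  calc freeSum G κ ℓ ω = ∑ x : A → Fin (n + 1), ∑ y : B → Fin (n + 1), G i (x (κ i)) (y (ℓ i)) ω *
        (G j (x (κ i)) (y (ℓ j)) ω * G k (x (κ k)) (y (ℓ j)) ω) := by
        refine sum_congr rfl fun x _ => sum_congr rfl fun y _ => ?_
        rw [huniv, prod_insert (by simp [hij, hik]), prod_pair hjk, ← hκij, ← hℓjk]
    _ = ∑ x : A → Fin (n + 1), ∑ b', ∑ b,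
          G i (x (κ i)) b' ω * (G j (x (κ i)) b ω * G k (x (κ k)) b ω) :=
        sum_congr rfl fun x _ => sum_fun_pair hℓij hB fun b' b =>
          G i (x (κ i)) b' ω * (G j (x (κ i)) b ω * G k (x (κ k)) b ω)
    _ = ∑ a, ∑ c, ∑ b', ∑ b, G i a b' ω * (G j a b ω * G k c b ω) :=
        sum_fun_pair hκik hA fun a c => ∑ b', ∑ b, G i a b' ω * (G j a b ω * G k c b ω)
    _ = ∑ a, ∑ c, ∑ b, ∑ b', G i a b' ω * (G j a b ω * G k c b ω) :=
        sum_congr rfl fun a _ => sum_congr rfl fun c _ => sum_comm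
    _ = ∑ b, ∑ a, ∑ c, ∑ b', G i a b' ω * (G j a b ω * G k c b ω) :=
        (sum_congr rfl fun a _ => sum_comm).trans sum_comm
    _ = _ := by
        refine sum_congr rfl fun b _ => ?_
        rw [sum_mul_sum, sum_comm]
        refine sum_congr rfl fun a _ => sum_congr rfl fun c _ => ?_
        rw [mul_sum]
        exact sum_congr rfl fun b' _ => by ring

end

namespace HaarSystem

variable {Ω W A B : Type*} [Fintype Ω] [Fintype W] [LinearOrder W] [Fintype A] [Fintype B]
  [DecidableEq A] [DecidableEq B] {n : ℕ} {τ : Fin 3 → ℕ → Equiv.Perm Ω}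
  {G : W → Fin (n + 1) → Fin (n + 1) → Ω → ℝ} {κ : W → A} {ℓ : W → B} {m : ℕ}

theorem freeSum_two (hG : HaarSystem n τ G) (hℓ : Function.Surjective ℓ)
    (hA : Fintype.card A = 1) (hB : Fintype.card B = 2) (hW : Fintype.card W = 2) (hm : 1 ≤ m) :
    MomentLE (2 * m) (freeSum G κ ℓ) (54 * m ^ 3 * (n + 1 : ℝ) ^ (7 / 4 : ℝ)) := by
  obtain ⟨i, j, hij, huniv⟩ := card_eq_two.1 (card_univ.trans hW)
  obtain ⟨_⟩ := Fintype.card_eq_one_iff_nonempty_unique.1 hA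
  have hinj : Function.Injective ℓ :=
    ((Fintype.bijective_iff_surjective_and_card ℓ).2 ⟨hℓ, by rw [hW, hB]⟩).1
  have hcolumn (a : Fin (n + 1)) : MomentLE (2 * (2 * m)) (fun ω => ∑ b', G j a b' ω)
      (3 * (2 * m : ℕ) * √(n + 1)) := by
    simpa using hG.column (singleton_nonempty j) (fun _ => a) (m := 2 * m) (by omega)
  have hpow : (n + 1 : ℝ) ^ (7 / 4 : ℝ) = √(n + 1) * (n + 1 : ℝ) ^ (5 / 4 : ℝ) := by
    rw [Real.sqrt_eq_rpow, ← Real.rpow_add (by positivity)]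
    norm_num
  rw [freeSum_eq_of_pair G hij huniv hℓ (hinj.ne hij), hpow]
  convert hG.pair hij hm (by positivity) hcolumn using 1
  push_cast
  ring

theorem freeSum_three (hG : HaarSystem n τ G) (hκ : Function.Surjective κ)
    (hℓ : Function.Surjective ℓ) (hA : Fintype.card A = 2) (hB : Fintype.card B = 2)
    (hW : Fintype.card W = 3) (hns : NoIsolated κ ℓ) (hm : 1 ≤ m) :
    MomentLE (2 * m) (freeSum G κ ℓ) (216 * m ^ 3 * (n + 1 : ℝ) ^ (11 / 4 : ℝ)) := by
  obtain ⟨i, j, k, hij, hik, hjk, huniv, hκij, hκik, hℓjk, hℓij⟩ :=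
    exists_path_of_card hκ hℓ hA hB hW hns
  have hcolumn (b : Fin (n + 1)) : MomentLE (2 * (2 * m)) (fun ω => ∑ c, G k c b ω)
      (3 * (2 * m : ℕ) * √(n + 1)) := by
    simpa using hG.swap.column (singleton_nonempty k) (fun _ => b) (m := 2 * m) (by omega)
  have hpair (b : Fin (n + 1)) : MomentLE (2 * (2 * m))
      (fun ω => ∑ a, ∑ b', G i a b' ω * G j a b ω)
      (9 * (2 * m : ℕ) ^ 2 * 1 * (n + 1 : ℝ) ^ (5 / 4 : ℝ)) := by
    simpa using hG.pair hij (T := {b}) (m := 2 * m) (by omega) one_pos fun a =>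
      MomentLE.of_abs_le fun ω => by simpa using hG.abs_le j a b ω
  have hpow : (n + 1 : ℝ) ^ (11 / 4 : ℝ) = (n + 1) * (√(n + 1) * (n + 1 : ℝ) ^ (5 / 4 : ℝ)) := by
    rw [Real.sqrt_eq_rpow, ← Real.rpow_add (by positivity), ← Real.rpow_one_add' (by positivity)
      (by norm_num)]
    norm_num
  rw [freeSum_eq_of_path G hij hik hjk huniv hκ hℓ hκij hκik hℓjk hℓij, hpow]
  convert MomentLE.sum (s := univ) (A := fun _ : Fin (n + 1) => 3 * (2 * m : ℕ) * √((n : ℝ) + 1) *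
    (9 * (2 * m : ℕ) ^ 2 * 1 * (n + 1 : ℝ) ^ (5 / 4 : ℝ))) (fun _ _ => by positivity)
    fun b _ => (hcolumn b).mul (by positivity) (by positivity) (hpair b) using 1
  simp only [sum_const, card_univ, Fintype.card_fin, nsmul_eq_mul]
  push_cast
  ring

end HaarSystem

theorem rpow_le_pow_rpow {N e d : ℝ} {v : ℕ} (hN : 1 ≤ N) (h : e ≤ d * v) :
    N ^ e ≤ (N ^ d) ^ v := by
  rw [← Real.rpow_natCast, ← Real.rpow_mul (by positivity)]
  exact Real.rpow_le_rpow_of_exponent_le hN h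

namespace HaarSystem

variable {Ω W A B : Type*} [Fintype Ω] [Fintype W] [Nonempty W] [LinearOrder W] [Fintype A]
  [Fintype B] [DecidableEq A] [DecidableEq B] {n : ℕ} {τ : Fin 3 → ℕ → Equiv.Perm Ω}
  {G : W → Fin (n + 1) → Fin (n + 1) → Ω → ℝ} {κ : W → A} {ℓ : W → B} {m : ℕ}

theorem freeSum_of_card_le (hG : HaarSystem n τ G) (hℓ : Function.Surjective ℓ)
    (hcard : 16 * Fintype.card A + 8 * Fintype.card B ≤ 15 * Fintype.card W) (hm : 1 ≤ m) :
    MomentLE (2 * m) (freeSum G κ ℓ)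
      ((216 * m ^ 3 * Fintype.card W * (n + 1 : ℝ) ^ (15 / 16 : ℝ)) ^ Fintype.card W) := by
  refine (hG.freeSum_columns (κ := κ) hℓ hm).mono (by positivity) ?_
  have hN : 1 ≤ (n + 1 : ℝ) := by simp
  have hm1 : (1 : ℝ) ≤ m := by exact_mod_cast hm
  have hW1 : (1 : ℝ) ≤ Fintype.card W := by exact_mod_cast Fintype.card_pos
  have hBW := Fintype.card_le_of_surjective ℓ hℓ
  have hB : (Fintype.card B : ℝ) ≤ Fintype.card W := by exact_mod_cast hBW
  have hpow : (n + 1 : ℝ) ^ Fintype.card A * √(n + 1) ^ Fintype.card B ≤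
      ((n + 1 : ℝ) ^ (15 / 16 : ℝ)) ^ Fintype.card W := by
    rw [Real.sqrt_eq_rpow, ← Real.rpow_mul_natCast (by positivity), ← Real.rpow_natCast,
      ← Real.rpow_add (by positivity)]
    refine rpow_le_pow_rpow hN ?_
    have : (16 * Fintype.card A + 8 * Fintype.card B : ℝ) ≤ 15 * Fintype.card W := by
      exact_mod_cast hcard
    linarith
  have hcoeff : (3 * (m * Fintype.card B) : ℝ) ^ Fintype.card B ≤
      (216 * (m ^ 3 * Fintype.card W)) ^ Fintype.card W := by
    have hm3 : (1 : ℝ) ≤ m ^ 3 := one_le_pow₀ hm1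
    calc (3 * (m * Fintype.card B) : ℝ) ^ Fintype.card B
        ≤ (216 * (m ^ 3 * Fintype.card W)) ^ Fintype.card B := by
          gcongr
          · norm_num
          · exact le_self_pow₀ hm1 (by norm_num)
      _ ≤ _ := pow_le_pow_right₀ (by nlinarith) hBW
  calc _ = (3 * (m * Fintype.card B) : ℝ) ^ Fintype.card B *
        ((n + 1) ^ Fintype.card A * √(n + 1) ^ Fintype.card B) := by
        push_cast
        ring
    _ ≤ _ := mul_le_mul hcoeff hpow (by positivity) (by positivity)
    _ = _ := by rw [← mul_pow]; ring

theorem freeSum_connected_of_le (hG : HaarSystem n τ G) (hκ : Function.Surjective κ)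
    (hℓ : Function.Surjective ℓ) (hns : NoIsolated κ ℓ)
    (htree : Fintype.card A + Fintype.card B ≤ Fintype.card W + 1)
    (hAB : Fintype.card A ≤ Fintype.card B) (hm : 1 ≤ m) :
    MomentLE (2 * m) (freeSum G κ ℓ)
      ((216 * m ^ 3 * Fintype.card W * (n + 1 : ℝ) ^ (15 / 16 : ℝ)) ^ Fintype.card W) := by
  by_cases hcard : 16 * Fintype.card A + 8 * Fintype.card B ≤ 15 * Fintype.card W
  · exact hG.freeSum_of_card_le hℓ hcard hm
  have hW2 : 1 < Fintype.card W := by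
    obtain ⟨j⟩ := ‹Nonempty W›
    obtain ⟨j', hne, -⟩ := hns j
    exact Fintype.one_lt_card_iff.2 ⟨j', j, hne⟩
  have hA1 : 0 < Fintype.card A := Fintype.card_pos_iff.2 (Nonempty.map κ inferInstance)
  -- The only shapes out of reach of the column bound.
  have hexceptional : (Fintype.card A = 1 ∧ Fintype.card B = 2 ∧ Fintype.card W = 2) ∨
      (Fintype.card A = 2 ∧ Fintype.card B = 2 ∧ Fintype.card W = 3) := by
    have := Fintype.card_le_of_surjective ℓ hℓ
    omega
  have hN : 1 ≤ (n + 1 : ℝ) := by simp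
  have hm3 : (1 : ℝ) ≤ m ^ 3 := one_le_pow₀ (by exact_mod_cast hm)
  rcases hexceptional with ⟨hA, hB, hW⟩ | ⟨hA, hB, hW⟩ <;> rw [hW, mul_pow]
  · refine (hG.freeSum_two hℓ hA hB hW hm).mono (by positivity) (mul_le_mul ?_
      (rpow_le_pow_rpow hN (by norm_num)) (by positivity) (by positivity))
    calc 54 * (m : ℝ) ^ 3 ≤ 216 * m ^ 3 * (2 : ℕ) := by push_cast; linarith
      _ ≤ _ := le_self_pow₀ (by push_cast; linarith) (by norm_num)
  · refine (hG.freeSum_three hκ hℓ hA hB hW hns hm).mono (by positivity) (mul_le_mul ?_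
      (rpow_le_pow_rpow hN (by norm_num)) (by positivity) (by positivity))
    calc 216 * (m : ℝ) ^ 3 ≤ 216 * m ^ 3 * (3 : ℕ) := by push_cast; linarith
      _ ≤ _ := le_self_pow₀ (by push_cast; linarith) (by norm_num)

theorem freeSum_connected (hG : HaarSystem n τ G) (hκ : Function.Surjective κ)
    (hℓ : Function.Surjective ℓ) (hns : NoIsolated κ ℓ)
    (htree : Fintype.card A + Fintype.card B ≤ Fintype.card W + 1) (hm : 1 ≤ m) :
    MomentLE (2 * m) (freeSum G κ ℓ)
      ((216 * m ^ 3 * Fintype.card W * (n + 1 : ℝ) ^ (15 / 16 : ℝ)) ^ Fintype.card W) := by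
  rcases le_total (Fintype.card A) (Fintype.card B) with h | h
  · exact hG.freeSum_connected_of_le hκ hℓ hns htree h hm
  · rw [← freeSum_swap]
    exact hG.swap.freeSum_connected_of_le hℓ hκ hns.swap (by omega) h hm

end HaarSystem

end Connected

section Components

theorem sum_pi_fiber {A K T M : Type*} [Fintype A] [DecidableEq A] [Fintype K] [DecidableEq K]
    [Fintype T] [AddCommMonoid M] (c : A → K) (F : (∀ k, {α // c α = k} → T) → M) :
    ∑ x : A → T, F (fun _ α => x α) = ∑ z, F z := by
  refine Fintype.sum_bijective (fun (x : A → T) (k : K) (α : {α // c α = k}) => x α)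
    ⟨fun x y h => ?_, fun z => ?_⟩ _ _ fun _ => rfl
  · funext α
    exact congrFun (congrFun h (c α)) ⟨α, rfl⟩
  · refine ⟨fun α => z (c α) ⟨α, rfl⟩, ?_⟩
    funext k ⟨α, hα⟩
    subst hα
    rfl

variable {W A B K : Type*} {κ : W → A} {ℓ : W → B} {cW : W → K} {cA : A → K} {cB : B → K}

/-- The map induced by `f` between the fibers over `k` of two labellings that `f` respects. -/
def fiberMap (f : W → A) (hf : ∀ j, cA (f j) = cW j) (k : K) (j : {j // cW j = k}) :
    {α // cA α = k} :=
  ⟨f j, (hf j).trans j.2⟩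

theorem fiberMap_surjective {f : W → A} (hf : ∀ j, cA (f j) = cW j) (hsurj : f.Surjective)
    (k : K) : (fiberMap f hf k).Surjective := by
  rintro ⟨α, hα⟩
  obtain ⟨j, rfl⟩ := hsurj α
  exact ⟨⟨j, (hf j).symm.trans hα⟩, rfl⟩

theorem NoIsolated.fiberMap (h : NoIsolated κ ℓ) (hA : ∀ j, cA (κ j) = cW j)
    (hB : ∀ j, cB (ℓ j) = cW j) (k : K) : NoIsolated (fiberMap κ hA k) (fiberMap ℓ hB k) := by
  rintro ⟨j, hj⟩
  obtain ⟨j', hne, hjj'⟩ := h j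
  have hj' : cW j' = k := hj ▸ hjj'.elim (fun h => by rw [← hA, ← h, hA])
    fun h => by rw [← hB, ← h, hB]
  exact ⟨⟨j', hj'⟩, fun h => hne (congrArg Subtype.val h),
    hjj'.imp (fun h => Subtype.ext h) fun h => Subtype.ext h⟩

theorem freeSum_eq_prod {Ω : Type*} {n : ℕ} [Fintype W] [Fintype A] [Fintype B] [DecidableEq A]
    [DecidableEq B] [Fintype K] [DecidableEq K] (G : W → Fin (n + 1) → Fin (n + 1) → Ω → ℝ)
    (hA : ∀ j, cA (κ j) = cW j) (hB : ∀ j, cB (ℓ j) = cW j) :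
    freeSum G κ ℓ = fun ω => ∏ k, freeSum (fun j : {j // cW j = k} => G j) (fiberMap κ hA k)
      (fiberMap ℓ hB k) ω := by
  funext ω
  simp only [freeSum]
  rw [prod_univ_sum, Fintype.piFinset_univ, ← sum_pi_fiber cA]
  refine sum_congr rfl fun x _ => ?_
  rw [prod_univ_sum, Fintype.piFinset_univ, ← sum_pi_fiber cB]
  refine sum_congr rfl fun y _ => ?_
  exact (Fintype.prod_fiberwise cW fun j => G j (x (κ j)) (y (ℓ j)) ω).symm

/-- The bipartite graph in which every `j` is an edge, joining the second parameter `κ j` to the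
third parameter `ℓ j`. -/
def incidenceGraph (κ : W → A) (ℓ : W → B) : SimpleGraph (A ⊕ B) :=
  .fromEdgeSet (Set.range fun j => s(.inl (κ j), .inr (ℓ j)))

theorem incidenceGraph_adj (κ : W → A) (ℓ : W → B) (j : W) :
    (incidenceGraph κ ℓ).Adj (.inl (κ j)) (.inr (ℓ j)) :=
  ⟨⟨j, rfl⟩, Sum.inl_ne_inr⟩

/-- The component of the incidence graph that contains the edge `j`. -/
abbrev edgeComponent (κ : W → A) (ℓ : W → B) (j : W) :
    (incidenceGraph κ ℓ).ConnectedComponent :=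
  (incidenceGraph κ ℓ).connectedComponentMk (.inl (κ j))

theorem connectedComponentMk_inr (κ : W → A) (ℓ : W → B) (j : W) :
    (incidenceGraph κ ℓ).connectedComponentMk (.inr (ℓ j)) = edgeComponent κ ℓ j :=
  SimpleGraph.ConnectedComponent.sound (incidenceGraph_adj κ ℓ j).reachable.symm

theorem edgeComponent_surjective (hκ : κ.Surjective) (hℓ : ℓ.Surjective) :
    (edgeComponent κ ℓ).Surjective := by
  refine SimpleGraph.ConnectedComponent.ind ?_
  rintro (α | β)
  · obtain ⟨j, rfl⟩ := hκ α
    exact ⟨j, rfl⟩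
  · obtain ⟨j, rfl⟩ := hℓ β
    exact ⟨j, (connectedComponentMk_inr κ ℓ j).symm⟩

theorem card_component_le [Finite W] [Finite A] [Finite B] (κ : W → A) (ℓ : W → B)
    (c : (incidenceGraph κ ℓ).ConnectedComponent) :
    Nat.card {α // (incidenceGraph κ ℓ).connectedComponentMk (.inl α) = c} +
      Nat.card {β // (incidenceGraph κ ℓ).connectedComponentMk (.inr β) = c} ≤
    Nat.card {j // edgeComponent κ ℓ j = c} + 1 := by
  let edge : {j // edgeComponent κ ℓ j = c} → Sym2 c := fun j =>
    s(⟨.inl (κ j), j.2⟩, ⟨.inr (ℓ j), (connectedComponentMk_inr κ ℓ j).trans j.2⟩)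
  have hedge : c.toSimpleGraph.edgeSet ⊆ Set.range edge := by
    rintro ⟨u, v⟩ ⟨⟨j, hj⟩, -⟩
    have hjc : edgeComponent κ ℓ j = c := by
      rcases Sym2.eq_iff.1 hj with ⟨hu, -⟩ | ⟨hv, -⟩
      · exact (congrArg _ hu).trans u.2
      · exact (congrArg _ hv).trans v.2
    exact ⟨⟨j, hjc⟩, Sym2.map.injective Subtype.val_injective hj⟩
  have hvert : Nat.card {v // (incidenceGraph κ ℓ).connectedComponentMk v = c} ≤ _ :=
    c.connected_toSimpleGraph.card_vert_le_card_edgeSet_add_one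
  have hcard := (Nat.card_mono (Set.finite_range edge) hedge).trans (Finite.card_range_le edge)
  rw [Nat.card_congr Equiv.subtypeSum, Nat.card_sum] at hvert
  exact hvert.trans (Nat.add_le_add_right hcard 1)

theorem HaarSystem.freeSum_component {Ω : Type*} [Fintype Ω] [Fintype W] [LinearOrder W]
    [Fintype A] [Fintype B] [DecidableEq A] [DecidableEq B]
    [DecidableEq (incidenceGraph κ ℓ).ConnectedComponent] {n : ℕ} {τ : Fin 3 → ℕ → Equiv.Perm Ω}
    {G : W → Fin (n + 1) → Fin (n + 1) → Ω → ℝ} (hG : HaarSystem n τ G)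
    (hκ : κ.Surjective) (hℓ : ℓ.Surjective) (hns : NoIsolated κ ℓ) {m : ℕ} (hm : 1 ≤ m)
    (c : (incidenceGraph κ ℓ).ConnectedComponent) :
    MomentLE (2 * m) (freeSum (fun j : {j // edgeComponent κ ℓ j = c} => G j)
        (fiberMap κ (cA := fun α => (incidenceGraph κ ℓ).connectedComponentMk (.inl α))
          (fun _ => rfl) c)
        (fiberMap ℓ (cA := fun β => (incidenceGraph κ ℓ).connectedComponentMk (.inr β))
          (connectedComponentMk_inr κ ℓ) c))
      ((216 * m ^ 3 * Fintype.card {j // edgeComponent κ ℓ j = c} * (n + 1 : ℝ) ^ (15 / 16 : ℝ)) ^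
        Fintype.card {j // edgeComponent κ ℓ j = c}) := by
  have : Nonempty {j // edgeComponent κ ℓ j = c} :=
    nonempty_subtype.2 (edgeComponent_surjective hκ hℓ c)
  refine (hG.comp (Subtype.strictMono_coe _)).freeSum_connected (fiberMap_surjective _ hκ c)
    (fiberMap_surjective _ hℓ c) (hns.fiberMap _ _ c) ?_ hm
  simpa only [Nat.card_eq_fintype_card] using card_component_le κ ℓ c

theorem HaarSystem.freeSum_le {Ω : Type*} [Fintype Ω] [Fintype W] [LinearOrder W] [Fintype A]
    [Fintype B] [DecidableEq A] [DecidableEq B] {n : ℕ} {τ : Fin 3 → ℕ → Equiv.Perm Ω}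
    {G : W → Fin (n + 1) → Fin (n + 1) → Ω → ℝ} (hG : HaarSystem n τ G)
    (hκ : κ.Surjective) (hℓ : ℓ.Surjective) (hns : NoIsolated κ ℓ) {m : ℕ} (hm : 1 ≤ m) :
    MomentLE (2 * m) (freeSum G κ ℓ)
      ((216 * m ^ 3 * Fintype.card W ^ 4 * (n + 1 : ℝ) ^ (15 / 16 : ℝ)) ^ Fintype.card W) := by
  classical
  rcases isEmpty_or_nonempty W with hW | hW
  · have := hκ.isEmpty
    have := hℓ.isEmpty
    exact MomentLE.of_abs_le (by simp [freeSum])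
  let K := (incidenceGraph κ ℓ).ConnectedComponent
  have : Fintype K := Fintype.ofFinite K
  have hsurj := edgeComponent_surjective hκ hℓ
  have : Nonempty K := hW.map (edgeComponent κ ℓ)
  have hKW : (Fintype.card K : ℝ) ≤ Fintype.card W := by
    exact_mod_cast Fintype.card_le_of_surjective _ hsurj
  set R : ℝ := 216 * m ^ 3 * Fintype.card W ^ 4 * (n + 1 : ℝ) ^ (15 / 16 : ℝ)
  have : 0 < R := by positivity
  have hprod : R ^ Fintype.card W =
      ∏ c : K, R ^ Fintype.card {j // edgeComponent κ ℓ j = c} := by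
    simpa using (Fintype.prod_fiberwise (edgeComponent κ ℓ) fun _ => R).symm
  rw [freeSum_eq_prod G (cA := fun α => (incidenceGraph κ ℓ).connectedComponentMk (.inl α))
    (cB := fun β => (incidenceGraph κ ℓ).connectedComponentMk (.inr β)) (fun _ => rfl)
    (connectedComponentMk_inr κ ℓ), hprod]
  refine MomentLE.prod (fun c _ => by positivity) fun c _ => ?_
  rw [card_univ, mul_assoc]
  refine (hG.freeSum_component hκ hℓ hns (Nat.mul_pos hm Fintype.card_pos) c).mono
    (by positivity) (pow_le_pow_left₀ (by positivity) ?_ _)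
  have hcW : (Fintype.card {j // edgeComponent κ ℓ j = c} : ℝ) ≤ Fintype.card W := by
    exact_mod_cast Fintype.card_subtype_le _
  push_cast
  calc _ ≤ 216 * ((m : ℝ) * Fintype.card W) ^ 3 * Fintype.card W * (n + 1 : ℝ) ^ (15 / 16 : ℝ) := by
        gcongr
    _ = R := by ring

end Components

section Colourings

theorem card_filter_leftInverse {A T : Type*} [Fintype A] [DecidableEq A] [Fintype T]
    [DecidableEq T] {x : A → T} (hx : x.Injective) :
    #{φ : T → A | ∀ α, φ (x α) = α} * Fintype.card A ^ Fintype.card A =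
      Fintype.card A ^ Fintype.card T := by
  have hset : ({φ : T → A | ∀ α, φ (x α) = α} : Finset (T → A)) =
      Fintype.piFinset fun t => {a : A | ∀ α, x α = t → a = α} := by
    ext φ
    simp only [mem_filter, mem_univ, true_and, Fintype.mem_piFinset]
    exact ⟨fun h t α hα => hα ▸ h α, fun h α => h (x α) α rfl⟩
  have hcard : ∀ t, #{a : A | ∀ α, x α = t → a = α} =
      if t ∈ univ.image x then 1 else Fintype.card A := by
    intro t
    split_ifs with ht
    · obtain ⟨β, -, rfl⟩ := mem_image.1 ht
      refine card_eq_one.2 ⟨β, ext fun a => ?_⟩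
      simp only [mem_filter, mem_univ, true_and, mem_singleton]
      exact ⟨fun h => h β rfl, fun h α hα => h.trans (hx hα).symm⟩
    · rw [filter_true_of_mem, card_univ]
      exact fun a _ α hα => absurd (mem_image.2 ⟨α, mem_univ _, hα⟩) ht
  have himage : #(univ.filter fun t => t ∉ univ.image x) + Fintype.card A = Fintype.card T := by
    rw [filter_notMem_eq_sdiff, ← card_univ (α := A), ← card_image_of_injective univ hx,
      card_sdiff_add_card_eq_card (subset_univ _), card_univ]
  rw [hset, Fintype.card_piFinset, prod_congr rfl fun t _ => hcard t, prod_ite, prod_const_one,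
    one_mul, prod_const, ← pow_add, himage]

/-- A random colouring `φ` of the values is a left inverse of a given injective assignment `x`
with probability `|A| ^ (-|A|)`, and a left inverse of no other assignment. -/
theorem sum_injective_eq {A T : Type*} [Fintype A] [DecidableEq A] [Nonempty A] [Fintype T]
    [DecidableEq T] (F : (A → T) → ℝ) :
    ∑ x with Function.Injective x, F x =
      (Fintype.card A ^ Fintype.card A / Fintype.card A ^ Fintype.card T : ℝ) *
        ∑ φ : T → A, ∑ x with ∀ α, φ (x α) = α, F x := by
  have hcount : ∑ φ : T → A, ∑ x with ∀ α, φ (x α) = α, F x =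
      ∑ x, #{φ : T → A | ∀ α, φ (x α) = α} * F x := by
    simp only [sum_filter]
    rw [sum_comm]
    refine sum_congr rfl fun x _ => ?_
    rw [← sum_filter, sum_const, nsmul_eq_mul]
  rw [hcount, mul_sum, sum_filter]
  refine sum_congr rfl fun x _ => ?_
  split_ifs with hx
  · have hcard : (#{φ : T → A | ∀ α, φ (x α) = α} : ℝ) * Fintype.card A ^ Fintype.card A =
        Fintype.card A ^ Fintype.card T := by
      exact_mod_cast card_filter_leftInverse hx
    field_simp
    linear_combination -F x * hcard
  · have hempty : ({φ : T → A | ∀ α, φ (x α) = α} : Finset (T → A)) = ∅ :=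
      filter_eq_empty_iff.2 fun φ _ h => hx (Function.LeftInverse.injective h)
    simp [hempty]

variable {Ω W A B : Type*} [Fintype W] [Fintype A] [Fintype B]
  [DecidableEq A] [DecidableEq B] {n : ℕ}
  {τ : Fin 3 → ℕ → Equiv.Perm Ω} {G : W → Fin (n + 1) → Fin (n + 1) → Ω → ℝ}
  {κ : W → A} {ℓ : W → B}

theorem sum_leftInverse_eq_freeSum (G : W → Fin (n + 1) → Fin (n + 1) → Ω → ℝ)
    (hκ : κ.Surjective) (hℓ : ℓ.Surjective) (φ : Fin (n + 1) → A) (ψ : Fin (n + 1) → B) (ω : Ω) :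
    ∑ x : A → Fin (n + 1) with ∀ α, φ (x α) = α, ∑ y : B → Fin (n + 1) with ∀ β, ψ (y β) = β,
        ∏ j, G j (x (κ j)) (y (ℓ j)) ω =
      freeSum (fun j a b ω => if φ a = κ j ∧ ψ b = ℓ j then G j a b ω else 0) κ ℓ ω := by
  simp only [freeSum, sum_filter]
  refine sum_congr rfl fun x _ => ?_
  split_ifs with hx
  · refine sum_congr rfl fun y _ => ?_
    split_ifs with hy
    · exact prod_congr rfl fun j _ => (if_pos ⟨hx _, hy _⟩).symm
    · obtain ⟨β, hβ⟩ := not_forall.1 hy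
      obtain ⟨j, rfl⟩ := hℓ β
      exact (prod_eq_zero (mem_univ j) (if_neg fun h => hβ h.2)).symm
  · obtain ⟨α, hα⟩ := not_forall.1 hx
    obtain ⟨j, rfl⟩ := hκ α
    exact (sum_eq_zero fun y _ => prod_eq_zero (mem_univ j) (if_neg fun h => hα h.1)).symm

theorem sum_injective_eq_sum_freeSum [Nonempty A] [Nonempty B] (hκ : κ.Surjective)
    (hℓ : ℓ.Surjective) (ω : Ω) :
    ∑ x : A → Fin (n + 1) with Function.Injective x,
      ∑ y : B → Fin (n + 1) with Function.Injective y, ∏ j, G j (x (κ j)) (y (ℓ j)) ω =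
    ((Fintype.card A ^ Fintype.card A / Fintype.card A ^ (n + 1) : ℝ) *
      (Fintype.card B ^ Fintype.card B / Fintype.card B ^ (n + 1) : ℝ)) *
      ∑ p : (Fin (n + 1) → A) × (Fin (n + 1) → B),
        freeSum (fun j a b ω => if p.1 a = κ j ∧ p.2 b = ℓ j then G j a b ω else 0) κ ℓ ω := by
  rw [sum_injective_eq, mul_assoc, Fintype.card_fin]
  simp only [sum_injective_eq, Fintype.card_fin, ← mul_sum, Fintype.sum_prod_type,
    ← sum_leftInverse_eq_freeSum G hκ hℓ]
  congr 2
  exact sum_congr rfl fun φ _ => sum_comm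

theorem HaarSystem.sum_injective_le [LinearOrder W] [Fintype Ω] [Nonempty W]
    (hG : HaarSystem n τ G) (hκ : κ.Surjective) (hℓ : ℓ.Surjective) (hns : NoIsolated κ ℓ)
    {m : ℕ} (hm : 1 ≤ m) :
    MomentLE (2 * m) (fun ω => ∑ x : A → Fin (n + 1) with Function.Injective x,
      ∑ y : B → Fin (n + 1) with Function.Injective y, ∏ j, G j (x (κ j)) (y (ℓ j)) ω)
      ((216 * m ^ 3 * Fintype.card W ^ 6 * (n + 1 : ℝ) ^ (15 / 16 : ℝ)) ^ Fintype.card W) := by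
  have : Nonempty A := Nonempty.map κ inferInstance
  have : Nonempty B := Nonempty.map ℓ inferInstance
  have hpow {c : ℕ} (hc : c ≤ Fintype.card W) :
      (c : ℝ) ^ c ≤ (Fintype.card W : ℝ) ^ Fintype.card W := by
    exact_mod_cast Nat.pow_self_mono hc
  simp only [sum_injective_eq_sum_freeSum hκ hℓ]
  have hsum := MomentLE.sum (s := (univ : Finset ((Fin (n + 1) → A) × (Fin (n + 1) → B))))
    (A := fun _ => (216 * m ^ 3 * Fintype.card W ^ 4 * (n + 1 : ℝ) ^ (15 / 16 : ℝ)) ^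
      Fintype.card W) (fun _ _ => by positivity) fun p _ =>
    (hG.restrict fun j a b => p.1 a = κ j ∧ p.2 b = ℓ j).freeSum_le hκ hℓ hns hm
  refine (hsum.const_mul (Fintype.card A ^ Fintype.card A / Fintype.card A ^ (n + 1) *
    (Fintype.card B ^ Fintype.card B / Fintype.card B ^ (n + 1)))).mono (by positivity) ?_
  rw [abs_of_pos (by positivity), sum_const, nsmul_eq_mul, card_univ, Fintype.card_prod,
    Fintype.card_fun, Fintype.card_fun, Fintype.card_fin]
  push_cast
  calc _ = (Fintype.card A : ℝ) ^ Fintype.card A * (Fintype.card B : ℝ) ^ Fintype.card B *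
        (216 * m ^ 3 * Fintype.card W ^ 4 * (n + 1 : ℝ) ^ (15 / 16 : ℝ)) ^ Fintype.card W := by
        field_simp
    _ ≤ (Fintype.card W : ℝ) ^ Fintype.card W * (Fintype.card W : ℝ) ^ Fintype.card W *
        (216 * m ^ 3 * Fintype.card W ^ 4 * (n + 1 : ℝ) ^ (15 / 16 : ℝ)) ^ Fintype.card W := by
        gcongr ?_ * ?_ * _
        · exact hpow (Fintype.card_le_of_surjective κ hκ)
        · exact hpow (Fintype.card_le_of_surjective ℓ hℓ)
    _ = _ := by
        rw [← mul_pow, ← mul_pow]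
        ring

end Colourings

section Kernels

variable {W T : Type*}

theorem setoid_out_injective :
    (fun (s : Setoid W) (j : W) => (Quotient.mk s j).out).Injective := fun s s' h => by
  have hker : ∀ s : Setoid W, Setoid.ker (fun j => (Quotient.mk s j).out) = s := fun s =>
    Setoid.ext fun i j => (Quotient.out_inj).trans Quotient.eq
  exact (hker s).symm.trans ((congrArg Setoid.ker h).trans (hker s'))

theorem noIsolated_comp_iff {A B S T : Type*} {κ : W → A} {ℓ : W → B} {x : A → S} {y : B → T}
    (hx : x.Injective) (hy : y.Injective) : NoIsolated (x ∘ κ) (y ∘ ℓ) ↔ NoIsolated κ ℓ := by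
  simp only [NoIsolated, Function.comp_apply, hx.eq_iff, hy.eq_iff]

variable [Fintype W]

noncomputable instance : Fintype (Setoid W) :=
  have := Finite.of_injective _ (setoid_out_injective (W := W))
  Fintype.ofFinite _

theorem card_setoid_le : Fintype.card (Setoid W) ≤ Fintype.card W ^ Fintype.card W := by
  classical
  simpa using Fintype.card_le_of_injective _ (setoid_out_injective (W := W))

open Classical in
/-- Every function factors uniquely as an injection of the quotient by its kernel. -/
theorem sum_eq_sum_setoid_sum_injective {M : Type*} [DecidableEq W] [Fintype T] [DecidableEq T]
    [AddCommMonoid M] (F : (W → T) → M) : ∑ a, F a =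
      ∑ s : Setoid W, ∑ x : Quotient s → T with Function.Injective x, F (x ∘ Quotient.mk s) := by
  rw [← sum_fiberwise univ Setoid.ker F]
  refine sum_congr rfl fun s _ => Eq.symm ?_
  refine sum_bij (fun x _ => x ∘ Quotient.mk s) ?_ ?_ ?_ fun _ _ => rfl
  · intro x hx
    refine mem_filter.2 ⟨mem_univ _, Setoid.ext fun i j => ?_⟩
    exact (mem_filter.1 hx).2.eq_iff.trans Quotient.eq
  · exact fun x _ y _ h => Quotient.mk_surjective.injective_comp_right h
  · intro a ha
    have hker := (mem_filter.1 ha).2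
    exact ⟨Quotient.lift a hker.ge, mem_filter.2 ⟨mem_univ _,
      (Setoid.lift_injective_iff_ker_eq_of_le hker.ge).2 hker⟩, rfl⟩

open Classical in
theorem sum_noIsolated_eq {M S : Type*} [DecidableEq W] [Fintype S] [DecidableEq S] [Fintype T]
    [DecidableEq T] [AddCommMonoid M] (F : (W → S) → (W → T) → M) :
    (∑ a, ∑ b, if NoIsolated a b then F a b else 0) =
      ∑ p : Setoid W × Setoid W with NoIsolated (Quotient.mk p.1) (Quotient.mk p.2),
        ∑ x : Quotient p.1 → S with Function.Injective x,
          ∑ y : Quotient p.2 → T with Function.Injective y,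
            F (x ∘ Quotient.mk p.1) (y ∘ Quotient.mk p.2) := by
  simp only [sum_eq_sum_setoid_sum_injective]
  rw [sum_filter, Fintype.sum_prod_type]
  refine sum_congr rfl fun s _ => ?_
  rw [sum_comm]
  refine sum_congr rfl fun s' _ => ?_
  have hiff : ∀ x ∈ ({x | Function.Injective x} : Finset (Quotient s → S)),
      ∀ y ∈ ({y | Function.Injective y} : Finset (Quotient s' → T)),
      (NoIsolated (x ∘ Quotient.mk s) (y ∘ Quotient.mk s') ↔
        NoIsolated (Quotient.mk s) (Quotient.mk s')) := fun x hx y hy =>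
    noIsolated_comp_iff (mem_filter.1 hx).2 (mem_filter.1 hy).2
  rw [sum_congr rfl fun x hx => sum_congr rfl fun y hy => if_congr (hiff x hx y hy) rfl rfl]
  split_ifs <;> simp

open Classical in
theorem HaarSystem.sum_noIsolated_le {Ω : Type*} {n : ℕ} {τ : Fin 3 → ℕ → Equiv.Perm Ω}
    {G : W → Fin (n + 1) → Fin (n + 1) → Ω → ℝ} [LinearOrder W] [Fintype Ω] [Nonempty W]
    (hG : HaarSystem n τ G) {m : ℕ} (hm : 1 ≤ m) :
    MomentLE (2 * m) (fun ω => ∑ a : W → Fin (n + 1), ∑ b : W → Fin (n + 1),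
      if NoIsolated a b then ∏ j, G j (a j) (b j) ω else 0)
      ((216 * m ^ 3 * Fintype.card W ^ 8 * (n + 1 : ℝ) ^ (15 / 16 : ℝ)) ^ Fintype.card W) := by
  have hsum := fun ω => sum_noIsolated_eq
    fun (a b : W → Fin (n + 1)) => ∏ j, G j (a j) (b j) ω
  simp only [hsum]
  refine (MomentLE.sum (A := fun _ => (216 * m ^ 3 * Fintype.card W ^ 6 *
    (n + 1 : ℝ) ^ (15 / 16 : ℝ)) ^ Fintype.card W) (fun _ _ => by positivity) fun p hp =>
    hG.sum_injective_le Quotient.mk_surjective Quotient.mk_surjective (mem_filter.1 hp).2 hm).mono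
    (by positivity) ?_
  have hcard : (#{p : Setoid W × Setoid W | NoIsolated (Quotient.mk p.1) (Quotient.mk p.2)} : ℝ) ≤
      (Fintype.card W : ℝ) ^ Fintype.card W * (Fintype.card W : ℝ) ^ Fintype.card W := by
    refine (Nat.cast_le.2 (card_le_univ _)).trans ?_
    rw [Fintype.card_prod]
    exact_mod_cast Nat.mul_le_mul card_setoid_le card_setoid_le
  rw [sum_const, nsmul_eq_mul]
  calc _ ≤ (Fintype.card W : ℝ) ^ Fintype.card W * (Fintype.card W : ℝ) ^ Fintype.card W *
        (216 * m ^ 3 * Fintype.card W ^ 6 * (n + 1 : ℝ) ^ (15 / 16 : ℝ)) ^ Fintype.card W := by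
        gcongr
    _ = _ := by
        rw [← mul_pow, ← mul_pow]
        ring

end Kernels

section DyadicGrid

theorem mem_dyadicInterval_iff {s j : ℕ} {x : ℝ} (hx : 0 ≤ x) :
    x ∈ dyadicInterval s j ↔ ⌊2 ^ s * x⌋₊ = j := by
  rw [Nat.floor_eq_iff (by positivity), dyadicInterval, Set.mem_Ico, div_le_iff₀ (by positivity),
    lt_div_iff₀ (by positivity), mul_comm x]

theorem haar_eq {s j : ℕ} {x : ℝ} (hx : 0 ≤ x) :
    haar s j x = -(if ⌊2 ^ (s + 1) * x⌋₊ = 2 * j then 1 else 0) +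
      if ⌊2 ^ (s + 1) * x⌋₊ = 2 * j + 1 then 1 else 0 := by
  have indicator_eq : ∀ a, (dyadicInterval (s + 1) a).indicator (1 : ℝ → ℝ) x =
      if ⌊2 ^ (s + 1) * x⌋₊ = a then 1 else 0 := fun a => by
    classical
    simp only [Set.indicator_apply, mem_dyadicInterval_iff hx, Pi.one_apply]
  rw [haar, indicator_eq, indicator_eq]

theorem floor_two_pow_mul_eq_div {M s : ℕ} (h : s ≤ M) (x : ℝ) :
    ⌊2 ^ s * x⌋₊ = ⌊2 ^ M * x⌋₊ / 2 ^ (M - s) := by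
  rw [← Nat.floor_div_natCast]
  congr 1
  push_cast
  rw [eq_div_iff (by positivity), mul_right_comm, ← pow_add, Nat.add_sub_cancel' h]

theorem haar_eq_haar_floor {M s j : ℕ} (h : s < M) {x : ℝ} (hx : 0 ≤ x) :
    haar s j x = haar s j (⌊2 ^ M * x⌋₊ / 2 ^ M) := by
  rw [haar_eq hx, haar_eq (by positivity), floor_two_pow_mul_eq_div h x,
    floor_two_pow_mul_eq_div h (_ / _), mul_div_cancel₀ _ (by positivity), Nat.floor_natCast]

theorem haar_natCast_div_two_pow {M s j K : ℕ} (h : s < M) :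
    haar s j ((K : ℝ) / 2 ^ M) = -(if K / 2 ^ (M - 1 - s) = 2 * j then 1 else 0) +
      if K / 2 ^ (M - 1 - s) = 2 * j + 1 then 1 else 0 := by
  rw [haar_eq (by positivity), floor_two_pow_mul_eq_div h (_ / _),
    mul_div_cancel₀ _ (by positivity), Nat.floor_natCast, Nat.sub_sub, add_comm 1 s]

theorem abs_haar_eq {s j : ℕ} {x : ℝ} (hx : 0 ≤ x) :
    |haar s j x| = if ⌊2 ^ s * x⌋₊ = j then 1 else 0 := by
  rw [haar_eq hx, floor_two_pow_mul_eq_div s.le_succ, Nat.succ_eq_add_one, Nat.add_sub_cancel_left]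
  generalize ⌊2 ^ (s + 1) * x⌋₊ = Q
  by_cases left : Q = 2 * j
  · rw [if_pos left, if_neg (by omega), if_pos (by omega)]
    norm_num
  by_cases right : Q = 2 * j + 1
  · rw [if_neg left, if_pos right, if_pos (by omega)]
    norm_num
  · rw [if_neg left, if_neg right, if_neg (by omega)]
    norm_num

theorem sum_abs_haar_le (s : ℕ) {x : ℝ} (hx : 0 ≤ x) :
    ∑ j : Fin (2 ^ s), |haar s j x| ≤ 1 := by
  simp only [abs_haar_eq hx]
  rw [sum_boole]
  have : #{j : Fin (2 ^ s) | ⌊2 ^ s * x⌋₊ = (j : ℕ)} ≤ 1 := card_le_one.2 fun a ha b hb =>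
    Fin.ext ((mem_filter.1 ha).2.symm.trans (mem_filter.1 hb).2)
  exact_mod_cast this

/-- Flip the `i`-th binary digit after the point of `K / 2 ^ M`, counted from `0`; this digit has
weight `2 ^ (M - 1 - i)` in `K`. Beyond the precision `M` this is the identity. -/
def flipDigit {M : ℕ} (i : ℕ) (K : Fin (2 ^ M)) : Fin (2 ^ M) :=
  if h : i < M then
    ⟨K ^^^ 2 ^ (M - 1 - i), Nat.xor_lt_two_pow K.2 (Nat.pow_lt_pow_right one_lt_two (by omega))⟩
  else K

theorem flipDigit_involutive {M : ℕ} (i : ℕ) :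
    Function.Involutive (flipDigit i : Fin (2 ^ M) → Fin (2 ^ M)) := by
  intro K
  unfold flipDigit
  split_ifs
  · simp
  · rfl

theorem xor_div_two_pow (K L e : ℕ) : (K ^^^ L) / 2 ^ e = K / 2 ^ e ^^^ L / 2 ^ e := by
  simpa only [Nat.shiftRight_eq_div_pow] using Nat.shiftRight_xor_distrib (a := K) (b := L) (i := e)

theorem haar_flipDigit_self {M s j : ℕ} (h : s < M) (K : Fin (2 ^ M)) :
    haar s j ((flipDigit s K : ℕ) / 2 ^ M) = -haar s j ((K : ℕ) / 2 ^ M) := by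
  rw [haar_natCast_div_two_pow h, haar_natCast_div_two_pow h, flipDigit, dif_pos h]
  simp only [xor_div_two_pow, Nat.div_self (Nat.two_pow_pos _)]
  generalize (K : ℕ) / 2 ^ (M - 1 - s) = Q
  have parity : (Q ^^^ 1) % 2 = (Q + 1) % 2 := Nat.xor_mod_two_eq
  have half : (Q ^^^ 1) / 2 = Q / 2 := by simpa using xor_div_two_pow Q 1 1
  have left_iff : Q ^^^ 1 = 2 * j ↔ Q = 2 * j + 1 := by omega
  have right_iff : Q ^^^ 1 = 2 * j + 1 ↔ Q = 2 * j := by omega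
  simp only [left_iff, right_iff]
  ring

theorem haar_flipDigit_of_lt {M s i j : ℕ} (h : s < M) (hi : s < i) (K : Fin (2 ^ M)) :
    haar s j ((flipDigit i K : ℕ) / 2 ^ M) = haar s j ((K : ℕ) / 2 ^ M) := by
  unfold flipDigit
  split_ifs with hiM
  · have div_eq : ((K : ℕ) ^^^ 2 ^ (M - 1 - i)) / 2 ^ (M - 1 - s) = K / 2 ^ (M - 1 - s) := by
      rw [xor_div_two_pow, Nat.div_eq_of_lt (Nat.pow_lt_pow_right one_lt_two (by omega)),
        Nat.xor_zero]
    rw [haar_natCast_div_two_pow h, haar_natCast_div_two_pow h, div_eq]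
  · rfl

/-- Flip the `i`-th binary digit of the `k`-th coordinate of a point of the dyadic grid. -/
def flipCoord (M : ℕ) (k : Fin 3) (i : ℕ) : Equiv.Perm (Fin 3 → Fin (2 ^ M)) :=
  Function.Involutive.toPerm (fun J => Function.update J k (flipDigit i (J k))) fun J => by
    simp [flipDigit_involutive i (J k)]

theorem flipCoord_apply (M : ℕ) (k : Fin 3) (i : ℕ) (J : Fin 3 → Fin (2 ^ M)) :
    flipCoord M k i J = Function.update J k (flipDigit i (J k)) := rfl

/-- The lower corner of the `J`-th dyadic cell of side `2 ^ (-M)`. -/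
noncomputable def corner (M : ℕ) (J : Fin 3 → Fin (2 ^ M)) (k : Fin 3) : ℝ := (J k : ℕ) / 2 ^ M

theorem corner_nonneg {M : ℕ} (J : Fin 3 → Fin (2 ^ M)) (k : Fin 3) : 0 ≤ corner M J k := by
  unfold corner
  positivity

theorem haarRect_flipCoord {M : ℕ} {r : Fin 3 → ℕ} (R : Rect r) (k : Fin 3) (i : ℕ) (c : ℝ)
    (J : Fin 3 → Fin (2 ^ M)) (h : haar (r k) (R k) ((flipDigit i (J k) : ℕ) / 2 ^ M) =
      c * haar (r k) (R k) ((J k : ℕ) / 2 ^ M)) :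
    haarRect r R (corner M (flipCoord M k i J)) = c * haarRect r R (corner M J) := by
  unfold haarRect
  rw [← mul_prod_erase univ _ (mem_univ k),
    ← mul_prod_erase univ (fun k => haar (r k) (R k) (corner M J k)) (mem_univ k), ← mul_assoc]
  congr 1
  · simpa [corner, flipCoord_apply] using h
  · refine prod_congr rfl fun k' hk' => ?_
    simp [corner, flipCoord_apply, Function.update_of_ne (ne_of_mem_erase hk')]

theorem IsRFunction.isLevel {M : ℕ} {r : Fin 3 → ℕ} {f : (Fin 3 → ℝ) → ℝ} (hf : IsRFunction r f)
    (k : Fin 3) (hk : r k < M) :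
    IsLevel (flipCoord M k) (r k) (fun J => f (corner M J)) := by
  obtain ⟨ε, -, hε⟩ := hf
  simp only [IsLevel, hε]
  refine ⟨fun J => ?_, fun i hi J => sum_congr rfl fun R _ => ?_⟩
  · rw [← sum_neg_distrib]
    refine sum_congr rfl fun R _ => ?_
    rw [haarRect_flipCoord R k (r k) (-1) J (by rw [haar_flipDigit_self hk, neg_one_mul])]
    ring
  · rw [haarRect_flipCoord R k i 1 J (by rw [haar_flipDigit_of_lt hk hi, one_mul]), one_mul]

theorem IsRFunction.abs_le {r : Fin 3 → ℕ} {f : (Fin 3 → ℝ) → ℝ} (hf : IsRFunction r f)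
    {x : Fin 3 → ℝ} (hx : ∀ k, 0 ≤ x k) : |f x| ≤ 1 := by
  obtain ⟨ε, hsign, hε⟩ := hf
  rw [hε]
  calc |∑ R, ε R * haarRect r R x| ≤ ∑ R, |ε R * haarRect r R x| := abs_sum_le_sum_abs _ _
    _ = ∑ R : Rect r, ∏ k, |haar (r k) (R k) (x k)| := sum_congr rfl fun R _ => by
        rw [abs_mul, haarRect, abs_prod]
        rcases hsign R with h | h <;> simp [h]
    _ = ∏ k, ∑ j : Fin (2 ^ r k), |haar (r k) j (x k)| := by
        rw [prod_univ_sum, Fintype.piFinset_univ]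
    _ ≤ 1 := prod_le_one (fun k _ => sum_nonneg fun _ _ => abs_nonneg _)
        fun k _ => sum_abs_haar_le (r k) (hx k)

/-- The index of the dyadic cell of side `2 ^ (-M)` that contains a point of the unit cube. The
coordinate `1` is assigned to the last cell. -/
noncomputable def cell (M : ℕ) (x : Fin 3 → ℝ) (k : Fin 3) : Fin (2 ^ M) :=
  ⟨min ⌊2 ^ M * x k⌋₊ (2 ^ M - 1), by have := Nat.two_pow_pos M; omega⟩

theorem IsRFunction.eq_corner_cell {M : ℕ} {r : Fin 3 → ℕ} {f : (Fin 3 → ℝ) → ℝ}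
    (hf : IsRFunction r f) (hr : ∀ k, r k < M) {x : Fin 3 → ℝ} (hx : ∀ k, x k ∈ Set.Ico (0 : ℝ) 1) :
    f x = f (corner M (cell M x)) := by
  obtain ⟨ε, -, hε⟩ := hf
  rw [hε, hε]
  refine sum_congr rfl fun R _ => congrArg (ε R * ·) (prod_congr rfl fun k _ => ?_)
  have hlt : ⌊2 ^ M * x k⌋₊ < 2 ^ M := by
    rw [Nat.floor_lt (mul_nonneg (by positivity) (hx k).1)]
    push_cast
    exact mul_lt_of_lt_one_right (by positivity) (hx k).2
  rw [haar_eq_haar_floor (hr k) (hx k).1]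
  simp only [corner, cell, min_eq_left (Nat.le_sub_one_of_lt hlt)]

theorem measurable_cell (M : ℕ) : Measurable (cell M) := by
  refine measurable_pi_lambda _ fun k => ?_
  exact (measurable_from_nat (f := fun a => (⟨min a (2 ^ M - 1), by
    have := Nat.two_pow_pos M; omega⟩ : Fin (2 ^ M)))).comp
    (Nat.measurable_floor.comp ((measurable_pi_apply k).const_mul _))

theorem mem_Icc_corner_cell {M : ℕ} {x : Fin 3 → ℝ} (hx : x ∈ Set.Icc 0 1) :
    x ∈ Set.Icc (corner M (cell M x)) (fun k => corner M (cell M x) k + (2 ^ M)⁻¹) := by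
  have hpos : (0 : ℝ) < 2 ^ M := by positivity
  have hx0 : ∀ k, 0 ≤ x k := hx.1
  have hx1 : ∀ k, x k ≤ 1 := hx.2
  refine ⟨fun k => ?_, fun k => ?_⟩
  · rw [corner, div_le_iff₀ hpos, mul_comm]
    exact (Nat.cast_le.2 (min_le_left _ _)).trans (Nat.floor_le (mul_nonneg hpos.le (hx0 k)))
  · change x k ≤ (cell M x k : ℕ) / 2 ^ M + (2 ^ M)⁻¹
    rw [← one_div, ← add_div, le_div_iff₀ hpos, mul_comm, cell]
    rcases min_choice ⌊2 ^ M * x k⌋₊ (2 ^ M - 1) with h | h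
    · simpa only [h] using (Nat.lt_floor_add_one _).le
    · simpa [h] using mul_le_of_le_one_right hpos.le (hx1 k)

theorem cubeMeasure_cell_le (M : ℕ) (J : Fin 3 → Fin (2 ^ M)) :
    cubeMeasure (cell M ⁻¹' {J}) ≤ ENNReal.ofReal (((2 : ℝ) ^ M) ^ 3)⁻¹ := by
  rw [cubeMeasure, Measure.restrict_apply (measurable_cell M (measurableSet_singleton J))]
  have hsub : cell M ⁻¹' {J} ∩ Set.Icc 0 1 ⊆
      Set.Icc (corner M J) (fun k => corner M J k + (2 ^ M)⁻¹) := by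
    rintro x ⟨rfl, hx⟩
    exact mem_Icc_corner_cell hx
  refine (measure_mono hsub).trans ?_
  rw [Real.volume_Icc_pi]
  simp only [add_sub_cancel_left, prod_const, card_univ, Fintype.card_fin]
  rw [← ENNReal.ofReal_pow (by positivity), inv_pow]

instance : IsProbabilityMeasure cubeMeasure := ⟨by
  rw [cubeMeasure, Measure.restrict_apply_univ, Real.volume_Icc_pi]
  simp⟩

theorem MomentLE.lintegral_cell_le {M k : ℕ} {Φ : (Fin 3 → Fin (2 ^ M)) → ℝ} {A : ℝ}
    (h : MomentLE k Φ A) :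
    ∫⁻ x, ‖Φ (cell M x)‖ₑ ^ k ∂cubeMeasure ≤ ENNReal.ofReal (A ^ k) := by
  rw [← lintegral_map (f := fun J => ‖Φ J‖ₑ ^ k) (measurable_of_finite _) (measurable_cell M),
    lintegral_fintype]
  calc ∑ J, ‖Φ J‖ₑ ^ k * (cubeMeasure.map (cell M)) {J}
      ≤ ∑ J, ENNReal.ofReal (|Φ J| ^ k * (((2 : ℝ) ^ M) ^ 3)⁻¹) := by
        refine sum_le_sum fun J _ => ?_
        rw [Measure.map_apply (measurable_cell M) (measurableSet_singleton J),
          Real.enorm_eq_ofReal_abs, ENNReal.ofReal_mul (by positivity),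
          ENNReal.ofReal_pow (abs_nonneg _)]
        gcongr
        exact cubeMeasure_cell_le M J
    _ = ENNReal.ofReal ((∑ J, |Φ J| ^ k) * (((2 : ℝ) ^ M) ^ 3)⁻¹) := by
        rw [← ENNReal.ofReal_sum_of_nonneg fun _ _ => by positivity, sum_mul]
    _ ≤ ENNReal.ofReal (A ^ k) := by
        refine ENNReal.ofReal_le_ofReal ?_
        rw [mul_inv_le_iff₀ (by positivity)]
        simpa [MomentLE] using h

theorem MomentLE.eLpNorm_le {M k : ℕ} (hk : k ≠ 0) {Φ : (Fin 3 → Fin (2 ^ M)) → ℝ} {A : ℝ}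
    (hA : 0 ≤ A) (h : MomentLE k Φ A) {p : ℝ} (hp : p ≤ k) :
    eLpNorm (fun x => Φ (cell M x)) (ENNReal.ofReal p) cubeMeasure ≤ ENNReal.ofReal A := by
  have hmeas : Measurable fun x => Φ (cell M x) := (measurable_of_finite Φ).comp (measurable_cell M)
  have hpk : ENNReal.ofReal p ≤ (k : ENNReal) :=
    (ENNReal.ofReal_le_ofReal hp).trans_eq (ENNReal.ofReal_natCast k)
  refine (eLpNorm_le_eLpNorm_of_exponent_le hpk hmeas.aestronglyMeasurable).trans ?_
  rw [eLpNorm_eq_lintegral_rpow_enorm_toReal (Nat.cast_ne_zero.2 hk) (ENNReal.natCast_ne_top k)]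
  simp only [ENNReal.toReal_natCast, ENNReal.rpow_natCast]
  calc (∫⁻ x, ‖Φ (cell M x)‖ₑ ^ k ∂cubeMeasure) ^ (1 / (k : ℝ))
      ≤ ENNReal.ofReal (A ^ k) ^ (1 / (k : ℝ)) := by
        gcongr
        exact h.lintegral_cell_le
    _ = ENNReal.ofReal A := by
        rw [ENNReal.ofReal_pow hA, one_div, ENNReal.pow_rpow_inv_natCast hk]

end DyadicGrid

section NSD

variable {n q : ℕ} {I : Fin q → Finset ℕ} {V : Finset (Fin q)}

theorem mem_hyp {r : Fin 3 → ℕ} : r ∈ hyp n ↔ r 0 + r 1 + r 2 = n := by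
  rw [hyp, Finset.Nat.mem_antidiagonalTuple, Fin.sum_univ_three]

theorem param_mem_block {a b : ℕ} {t : Fin q} :
    param n a b ∈ block n I t ↔ a + b ≤ n ∧ n - a - b ∈ I t := by
  rw [block, mem_filter, mem_hyp]
  refine and_congr_left fun _ => ?_
  change n - a - b + a + b = n ↔ a + b ≤ n
  omega

theorem exists_param_eq {r : Fin 3 → ℕ} (hr : r ∈ hyp n) :
    ∃ a b : Fin (n + 1), param n a b = r := by
  have hsum := mem_hyp.1 hr
  refine ⟨⟨r 1, by omega⟩, ⟨r 2, by omega⟩, funext fun k => ?_⟩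
  fin_cases k
  · change n - r 1 - r 2 = r 0
    omega
  · rfl
  · rfl

theorem mem_NSD {r : V → Fin 3 → ℕ} : r ∈ NSD n I V ↔
    (∀ j : V, r j ∈ block n I j) ∧ NoIsolated (fun j => r j 1) (fun j => r j 2) := by
  rw [NSD, mem_filter, Fintype.mem_piFinset, NoIsolated]

theorem param_mem_NSD {a b : V → Fin (n + 1)} : (fun j => param n (a j) (b j)) ∈ NSD n I V ↔
    NoIsolated a b ∧ ∀ j : V, param n (a j) (b j) ∈ block n I j := by
  rw [mem_NSD, and_comm]
  exact and_congr_left' (noIsolated_comp_iff Fin.val_injective Fin.val_injective)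

theorem sum_NSD_eq {M : Type*} [AddCommMonoid M] (F : (V → Fin 3 → ℕ) → M) :
    ∑ r ∈ NSD n I V, F r = ∑ a : V → Fin (n + 1), ∑ b : V → Fin (n + 1),
      if (fun j => param n (a j) (b j)) ∈ NSD n I V then F fun j => param n (a j) (b j)
      else 0 := by
  rw [← Fintype.sum_prod_type' (f := fun a b : V → Fin (n + 1) =>
    if (fun j => param n (a j) (b j)) ∈ NSD n I V then F fun j => param n (a j) (b j) else 0),
    ← sum_filter]
  refine (sum_bij (fun p _ j => param n (p.1 j) (p.2 j)) (fun p hp => (mem_filter.1 hp).2)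
    ?_ ?_ fun _ _ => rfl).symm
  · intro p _ p' _ h
    exact Prod.ext (funext fun j => Fin.ext (congrFun (congrFun h j) 1))
      (funext fun j => Fin.ext (congrFun (congrFun h j) 2))
  · intro r hr
    choose a b hab using fun j => exists_param_eq (mem_filter.1 ((mem_NSD.1 hr).1 j)).1
    obtain rfl : (fun j => param n (a j) (b j)) = r := funext hab
    exact ⟨(a, b), mem_filter.2 ⟨mem_univ _, hr⟩, rfl⟩

/-- The r-functions `f r` with `r` in the `j`-th block, listed by the parameters of `r` and sampled
at the corners of the dyadic cells of side `2 ^ (-(n + 1))`, on which all of them are constant. -/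
noncomputable def gridSystem (n : ℕ) (I : Fin q → Finset ℕ) (f : (Fin 3 → ℕ) → (Fin 3 → ℝ) → ℝ)
    (V : Finset (Fin q)) (j : V) (a b : Fin (n + 1)) (J : Fin 3 → Fin (2 ^ (n + 1))) : ℝ :=
  if param n a b ∈ block n I j then f (param n a b) (corner (n + 1) J) else 0

theorem lt_succ_of_mem_hyp {r : Fin 3 → ℕ} (hr : r ∈ hyp n) (k : Fin 3) : r k < n + 1 := by
  have hsum := mem_hyp.1 hr
  fin_cases k <;> simp only [Fin.reduceFinMk, Fin.zero_eta, Fin.mk_one] <;> omega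

variable {f : (Fin 3 → ℕ) → (Fin 3 → ℝ) → ℝ}

theorem haarSystem_gridSystem (hI : ∀ s t, s < t → ∀ x ∈ I s, ∀ y ∈ I t, x < y)
    (hf : ∀ r ∈ hyp n, IsRFunction r (f r)) (V : Finset (Fin q)) :
    HaarSystem n (flipCoord (n + 1)) (gridSystem n I f V) := by
  have hne : ∀ {j : V} {a b : Fin (n + 1)}, gridSystem n I f V j a b ≠ 0 →
      (a : ℕ) + b ≤ n ∧ n - a - b ∈ I j := fun h =>
    param_mem_block.1 (by_contra fun hmem => h (funext fun _ => if_neg hmem))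
  constructor
  · intro j a b J
    unfold gridSystem
    split_ifs with hmem
    · exact (hf _ (mem_filter.1 hmem).1).abs_le (corner_nonneg J)
    · simp
  · intro j a b k
    by_cases hmem : param n a b ∈ block n I j
    · have hr := (mem_filter.1 hmem).1
      have hsample : gridSystem n I f V j a b = fun J => f (param n a b) (corner (n + 1) J) :=
        funext fun _ => if_pos hmem
      exact hsample ▸ (hf _ hr).isLevel k (lt_succ_of_mem_hyp hr k)
    · simp [IsLevel, gridSystem, if_neg hmem]
  · exact fun h => (hne h).1
  · intro i j a b a' b' hij h h'
    have := hI i j hij _ (hne h).2 _ (hne h').2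
    omega

open Classical in
theorem sumProd_NSD_ae_eq (hf : ∀ r ∈ hyp n, IsRFunction r (f r)) (V : Finset (Fin q)) :
    sumProd f (NSD n I V) =ᵐ[cubeMeasure] fun x =>
      ∑ a : V → Fin (n + 1), ∑ b : V → Fin (n + 1), if NoIsolated a b then
        ∏ j, gridSystem n I f V j (a j) (b j) (cell (n + 1) x) else 0 := by
  have hset : (Set.Icc 0 1 : Set (Fin 3 → ℝ)) =ᵐ[volume] Set.univ.pi fun _ => Set.Ico (0 : ℝ) 1 :=
    (Measure.univ_pi_Ico_ae_eq_Icc (f := (0 : Fin 3 → ℝ)) (g := 1)).symm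
  rw [cubeMeasure, Measure.restrict_congr_set hset]
  filter_upwards [ae_restrict_mem (MeasurableSet.univ_pi fun _ => measurableSet_Ico)] with x hx
  rw [sumProd, sum_NSD_eq]
  refine sum_congr rfl fun a _ => sum_congr rfl fun b _ => ?_
  simp only [gridSystem, prod_ite_zero, mem_univ, true_imp_iff, param_mem_NSD, ite_and]
  refine if_congr Iff.rfl (ite_congr rfl (fun hmem => prod_congr rfl fun j _ => ?_)
    fun _ => rfl) rfl
  have hr := (mem_filter.1 (hmem j)).1
  exact (hf _ hr).eq_corner_cell (lt_succ_of_mem_hyp hr) fun k => hx k (Set.mem_univ k)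

theorem sumProd_NSD_empty : sumProd f (NSD n I ∅) = fun _ => 1 := by
  funext x
  simp [sumProd, NSD]

theorem eLpNorm_sumProd_NSD_le (hI : ∀ s t, s < t → ∀ x ∈ I s, ∀ y ∈ I t, x < y)
    (hf : ∀ r ∈ hyp n, IsRFunction r (f r)) (V : Finset (Fin q)) {m : ℕ} {p : ℝ} (hp0 : 0 < p)
    (hp : p ≤ 2 * m) :
    eLpNorm (sumProd f (NSD n I V)) (ENNReal.ofReal p) cubeMeasure ≤
      ENNReal.ofReal ((216 * m ^ 3 * #V ^ 8 * (n + 1 : ℝ) ^ (15 / 16 : ℝ)) ^ #V) := by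
  rcases V.eq_empty_or_nonempty with rfl | hV
  · rw [sumProd_NSD_empty, eLpNorm_const _ (ENNReal.ofReal_pos.2 hp0).ne'
      (IsProbabilityMeasure.ne_zero _)]
    simp
  have : Nonempty V := hV.to_subtype
  have hm : 0 < m := by exact_mod_cast (by linarith : (0 : ℝ) < m)
  have hmoment := (haarSystem_gridSystem hI hf V).sum_noIsolated_le hm
  rw [Fintype.card_coe] at hmoment
  rw [eLpNorm_congr_ae (sumProd_NSD_ae_eq hf V)]
  exact hmoment.eLpNorm_le (by omega) (by positivity) (by exact_mod_cast hp)

theorem add_one_rpow_div_le {x θ : ℝ} (hx : 1 ≤ x) (hθ0 : 0 ≤ θ) (hθ1 : θ ≤ 1) :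
    (x + 1) ^ θ / x ≤ 2 * x ^ (θ - 1) := by
  have hx0 : 0 < x := by linarith
  rw [Real.rpow_sub_one hx0.ne', ← mul_div_assoc]
  gcongr
  calc (x + 1) ^ θ ≤ (2 * x) ^ θ := Real.rpow_le_rpow (by linarith) (by linarith) hθ0
    _ = 2 ^ θ * x ^ θ := Real.mul_rpow zero_le_two hx0.le
    _ ≤ 2 * x ^ θ := by
        gcongr
        exact Real.rpow_le_self_of_one_le one_le_two hθ1

end NSD
end BeckGain

open BeckGain MeasureTheory in
theorem mainTheorem3_general {n q : ℕ} (hn : 1 ≤ n) {I : Fin q → Finset ℕ}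
    (hI : ∀ s t, s < t → ∀ x ∈ I s, ∀ y ∈ I t, x < y) {f : (Fin 3 → ℕ) → (Fin 3 → ℝ) → ℝ}
    (hf : ∀ r ∈ hyp n, IsRFunction r (f r)) (V : Finset (Fin q)) {p : ℝ} (hp : 1 ≤ p) :
    ENNReal.ofReal (rho q n ^ V.card) *
        eLpNorm (sumProd f (NSD n I V)) (ENNReal.ofReal p) cubeMeasure ≤
      ENNReal.ofReal ((3456 * (V.card : ℝ) ^ (8 : ℝ) * p ^ (3 : ℝ) * (q : ℝ) ^ (1 / 2 : ℝ) *
        (n : ℝ) ^ (-(1 / 16) : ℝ)) ^ V.card) := by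
  obtain ⟨m, hpm, hmp⟩ : ∃ m : ℕ, p ≤ m ∧ (m : ℝ) ≤ 2 * p :=
    ⟨⌈p⌉₊, Nat.le_ceil p, by linarith [Nat.ceil_lt_add_one (by linarith : 0 ≤ p)]⟩
  have hLp := eLpNorm_sumProd_NSD_le hI hf V (m := m) (by linarith) (by linarith : p ≤ 2 * m)
  refine (mul_le_mul_right hLp _).trans ?_
  rw [← ENNReal.ofReal_mul (by unfold rho; positivity), ← mul_pow]
  refine ENNReal.ofReal_le_ofReal (pow_le_pow_left₀ (by unfold rho; positivity) ?_ _)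
  have hpower : (n + 1 : ℝ) ^ (15 / 16 : ℝ) / n ≤ 2 * (n : ℝ) ^ (-(1 / 16) : ℝ) := by
    convert add_one_rpow_div_le (θ := 15 / 16) (Nat.one_le_cast.2 hn) (by norm_num) (by norm_num)
      using 3
    norm_num
  rw [rho, Real.sqrt_eq_rpow]
  simp only [Real.rpow_ofNat]
  calc (q : ℝ) ^ (1 / 2 : ℝ) / n * (216 * m ^ 3 * V.card ^ 8 * (n + 1 : ℝ) ^ (15 / 16 : ℝ))
      = 216 * m ^ 3 * V.card ^ 8 * (q : ℝ) ^ (1 / 2 : ℝ) *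
        ((n + 1 : ℝ) ^ (15 / 16 : ℝ) / n) := by ring
    _ ≤ 216 * (2 * p) ^ 3 * V.card ^ 8 * (q : ℝ) ^ (1 / 2 : ℝ) *
        (2 * (n : ℝ) ^ (-(1 / 16) : ℝ)) := by gcongr
    _ = 3456 * V.card ^ 8 * p ^ 3 * (q : ℝ) ^ (1 / 2 : ℝ) * (n : ℝ) ^ (-(1 / 16) : ℝ) := by ring

theorem mainTheorem3 :
    ∃ C₀ C₁ C₂ C₃ η : ℝ, 0 < C₀ ∧ 0 < C₁ ∧ 0 < C₂ ∧ 0 < C₃ ∧ 0 < η ∧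
      ∀ (n q : ℕ) (_ : 1 ≤ n) (I : Fin q → Finset ℕ) (_ : BeckGain.IsIntervalDivision n I)
        (f : (Fin 3 → ℕ) → (Fin 3 → ℝ) → ℝ)
        (_ : ∀ r ∈ BeckGain.hyp n, BeckGain.IsRFunction r (f r))
        (V : Finset (Fin q)) (p : ℝ) (_ : 1 ≤ p),
        ENNReal.ofReal (BeckGain.rho q n ^ V.card) *
            MeasureTheory.eLpNorm (BeckGain.sumProd f (BeckGain.NSD n I V))
              (ENNReal.ofReal p) BeckGain.cubeMeasure ≤
          ENNReal.ofReal
            ((C₀ * (V.card : ℝ) ^ C₁ * p ^ C₂ * (q : ℝ) ^ C₃ * (n : ℝ) ^ (-η)) ^ V.card) :=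
  ⟨3456, 8, 3, 1 / 2, 1 / 16, by norm_num, by norm_num, by norm_num, by norm_num, by norm_num,
    fun _ _ hn _ hI _ hf V _ hp => mainTheorem3_general hn hI.increasing hf V hp⟩
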